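/- Notation. Let $\mathsf H_m=\sum_{j=1}^m\frac1j$. For $\nu\in(-1,0)$ and $t\in\mathbb C\smallsetminus[1,\infty)$ let $$P_\nu(1-2t)=-\frac{\sin(\nu\pi)}{\pi}\int_0^1\left[\frac{X(1-tX)}{1-X}\right]^\nu\frac{dX}{1-X}$$ be the Legendre function of degree $\nu$. Logarithms and powers take their principal values ($\operatorname{Im}\log\in(-\pi,\pi]$), $t$ is a complex number, and each series is understood as the limit of its partial sums (convergence need not be absolute). **Theorem (Legendre–Sun series).** (a) For $|t|\le1$, $t\ne1$, the following series converge and $$\mathsf S^L_{-1/2}(t):=2\sum_{k=1}^\infty\binom{2k}k^2\left(\frac t{2^4}\right)^k(2\mathsf H_{2k}-\mathsf H_k)=-P_{-1/2}(1-2t)\log(1-t),$$ $$\mathsf S^L_{-1/3}(t):=\sum_{k=1}^\infty\binom{2k}k\binom{3k}k\left(\frac t{3^3}\right)^k(3\mathsf H_{3k}-\mathsf H_k)=-P_{-1/3}(1-2t)\log(1-t),$$ $$\mathsf S^L_{-1/4}(t):=2\sum_{k=1}^\infty\binom{2k}k\binom{4k}{2k}\left(\frac t{2^6}\right)^k(2\mathsf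 H_{4k}-\mathsf H_{2k})=-P_{-1/4}(1-2t)\log(1-t),$$ $$\mathsf S^L_{-1/6}(t):=\sum_{k=1}^\infty\binom{3k}k\binom{6k}{3k}\left(\frac t{2^43^3}\right)^k(6\mathsf H_{6k}-3\mathsf H_{3k}-2\mathsf H_{2k}+\mathsf H_k)=-P_{-1/6}(1-2t)\log(1-t).$$ (b) For $|t|\le1$, $t\notin[-1,0]\cup\{1\}$, the following series converge and $$\widetilde{\mathsf S}^L_{-1/2}(t):=-\sum_{k=1}^\infty\binom{2k}k^2\left(\frac t{2^4}\right)^k\mathsf H_k=-\frac{\pi P_{-1/2}(2t-1)}2+\frac{P_{-1/2}(1-2t)}2\log\frac{2^4(1-t)}t,$$ $$\widetilde{\mathsf S}^L_{-1/3}(t):=-\sum_{k=1}^\infty\binom{2k}k\binom{3k}k\left(\frac t{3^3}\right)^k\mathsf H_k=-\frac{\pi P_{-1/3}(2t-1)}{\sqrt3}+\frac{P_{-1/3}(1-2t)}2\log\frac{3^3(1-t)}t,$$ $$\widetilde{\mathsf S}^L_{-1/4}(t):=-\sum_{k=1}^\infty\binom{2k}k\binom{4k}{2k}\left(\frac t{2^6}\right)^k\mathsf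 H_k=-\frac{\pi P_{-1/4}(2t-1)}{\sqrt2}+\frac{P_{-1/4}(1-2t)}2\log\frac{2^6(1-t)}t,$$ $$\widetilde{\mathsf S}^L_{-1/6}(t):=-\sum_{k=1}^\infty\binom{3k}k\binom{6k}{3k}\left(\frac t{2^43^3}\right)^k\mathsf H_k=-\pi P_{-1/6}(2t-1)+\frac{P_{-1/6}(1-2t)}2\log\frac{2^43^3(1-t)}t.$$ Moreover, for real $t\in[-1,0)$ and each $\nu\in\{-\frac12,-\frac13,-\frac14,-\frac16\}$, the series $\widetilde{\mathsf S}^L_\nu(t)$ converges, and its sum is the limit, as $\varepsilon\to0^+$, of the right-hand side of the corresponding identity in (b) evaluated at $t+i\varepsilon$, and also of that evaluated at $t-i\varepsilon$. For $-1<t<0$ one also has $\widetilde{\mathsf S}^L_\nu(t)=\lim_{\varepsilon\to0^+}\widetilde{\mathsf S}^L_\nu(t\pm i\varepsilon)$ for the sums of the series themselves. -/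

import Mathlib

open Filter Topology

noncomputable section

namespace LegendreSun

/-- The Legendre function of degree `ν ∈ (-1, 0)`, given for `ξ = 1 - 2 t` with
`t ∈ ℂ ∖ [1, ∞)`, that is for `ξ ∈ ℂ ∖ (-∞, -1]`, by
`P_ν(1 - 2 t) = -(sin (ν π) / π) ∫₀¹ [X (1 - t X) / (1 - X)] ^ ν dX / (1 - X)`,
with the principal branch of the power. -/
def legendreP (ν : ℝ) (ξ : ℂ) : ℂ :=
  -((Real.sin (ν * Real.pi) / Real.pi : ℝ) : ℂ) *
    ∫ X in (0 : ℝ)..1,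
      ((X : ℂ) * (1 - (1 - ξ) / 2 * (X : ℂ)) / (1 - (X : ℂ))) ^ (ν : ℂ) / (1 - (X : ℂ))

/-- The partial sums `a 1 + ⋯ + a n`. -/
def partialSum (a : ℕ → ℂ) (n : ℕ) : ℂ := ∑ k ∈ Finset.Icc 1 n, a k

/-- The series `∑_{k ≥ 1} a k` converges: its partial sums, taken in the natural order, have a limit
(convergence need not be absolute). -/
def SeriesConverges (a : ℕ → ℂ) : Prop := ∃ s : ℂ, Tendsto (partialSum a) atTop (𝓝 s)

/-- The sum of the series `∑_{k ≥ 1} a k`, the limit of its partial sums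
(meaningful when `SeriesConverges a`). -/
def seriesSum (a : ℕ → ℂ) : ℂ := limUnder atTop (partialSum a)

/-- The `k`-th harmonic number, as a complex number. -/
def H (k : ℕ) : ℂ := ((harmonic k : ℚ) : ℂ)

/-! The addends of the series without the harmonic weights. -/

/-- `binom(2k,k)² (t / 2⁴)^k`. -/
def base2 (t : ℂ) (k : ℕ) : ℂ := (Nat.choose (2 * k) k : ℂ) ^ 2 * (t / 2 ^ 4) ^ k

/-- `binom(2k,k) binom(3k,k) (t / 3³)^k`. -/
def base3 (t : ℂ) (k : ℕ) : ℂ :=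
  (Nat.choose (2 * k) k : ℂ) * (Nat.choose (3 * k) k : ℂ) * (t / 3 ^ 3) ^ k

/-- `binom(2k,k) binom(4k,2k) (t / 2⁶)^k`. -/
def base4 (t : ℂ) (k : ℕ) : ℂ :=
  (Nat.choose (2 * k) k : ℂ) * (Nat.choose (4 * k) (2 * k) : ℂ) * (t / 2 ^ 6) ^ k

/-- `binom(3k,k) binom(6k,3k) (t / (2⁴ 3³))^k`. -/
def base6 (t : ℂ) (k : ℕ) : ℂ :=
  (Nat.choose (3 * k) k : ℂ) * (Nat.choose (6 * k) (3 * k) : ℂ) * (t / (2 ^ 4 * 3 ^ 3)) ^ k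

/-! The addends of the series `S_ν(t)`, for `ν = -1/2, -1/3, -1/4, -1/6`. -/

def term2 (t : ℂ) (k : ℕ) : ℂ := base2 t k * (2 * H (2 * k) - H k)

def term3 (t : ℂ) (k : ℕ) : ℂ := base3 t k * (3 * H (3 * k) - H k)

def term4 (t : ℂ) (k : ℕ) : ℂ := base4 t k * (2 * H (4 * k) - H (2 * k))

def term6 (t : ℂ) (k : ℕ) : ℂ :=
  base6 t k * (6 * H (6 * k) - 3 * H (3 * k) - 2 * H (2 * k) + H k)

/-- The series `S_{-1/2}(t)`. -/
def S2 (t : ℂ) : ℂ := 2 * seriesSum (term2 t)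

/-- The series `S_{-1/3}(t)`. -/
def S3 (t : ℂ) : ℂ := seriesSum (term3 t)

/-- The series `S_{-1/4}(t)`. -/
def S4 (t : ℂ) : ℂ := 2 * seriesSum (term4 t)

/-- The series `S_{-1/6}(t)`. -/
def S6 (t : ℂ) : ℂ := seriesSum (term6 t)

/-- The series `-∑_{k ≥ 1} b_k(t) H_k`, for addends `b_k(t)`. The series `S̃_ν(t)` with
`ν = -1/2, -1/3, -1/4, -1/6` are obtained for `b = base2, base3, base4, base6`. -/
def STilde (b : ℂ → ℕ → ℂ) (t : ℂ) : ℂ := -seriesSum (fun k => b t k * H k)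

/-- The closed form `-π P_ν(2t - 1) / r + (P_ν(1 - 2t) / 2) log (c (1 - t) / t)`. -/
def closedForm (ν r c : ℝ) (t : ℂ) : ℂ :=
  -((Real.pi : ℂ) * legendreP ν (2 * t - 1) / (r : ℂ)) +
    legendreP ν (1 - 2 * t) / 2 * Complex.log ((c : ℂ) * (1 - t) / t)

/-- `f (t + i ε) → s` and `f (t - i ε) → s` as `ε → 0⁺`. -/
def VerticalLimits (f : ℂ → ℂ) (t : ℝ) (s : ℂ) : Prop :=
  Tendsto (fun ε : ℝ => f ((t : ℂ) + Complex.I * (ε : ℂ))) (𝓝[>] 0) (𝓝 s) ∧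
  Tendsto (fun ε : ℝ => f ((t : ℂ) - Complex.I * (ε : ℂ))) (𝓝[>] 0) (𝓝 s)

/-- The statement about one of the series `S̃_ν`: for complex `t` with `|t| ≤ 1` and
`t ∉ [-1, 0] ∪ {1}`, the series converges to the closed form with the constants `ν, r, c`;
for real `t ∈ [-1, 0)`, it converges and its sum is the limit of the closed form (the function
`S̃_ν`, continued analytically through the open upper or lower half-plane) at `t ± i ε`; for
`-1 < t < 0`, it is also the limit of the sum of the series itself at `t ± i ε`. -/
def TildeEvaluation (b : ℂ → ℕ → ℂ) (ν r c : ℝ) : Prop :=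
  (∀ t : ℂ, ‖t‖ ≤ 1 → t ≠ 1 → (¬ ∃ x : ℝ, -1 ≤ x ∧ x ≤ 0 ∧ t = (x : ℂ)) →
    SeriesConverges (fun k => b t k * H k) ∧ STilde b t = closedForm ν r c t) ∧
  (∀ t : ℝ, -1 ≤ t → t < 0 →
    SeriesConverges (fun k => b (t : ℂ) k * H k) ∧
    VerticalLimits (closedForm ν r c) t (STilde b (t : ℂ)) ∧
    (-1 < t → VerticalLimits (STilde b) t (STilde b (t : ℂ))))

end LegendreSun

end

/-!
Put `a = -ν ∈ (0, 1)`. In all four cases the binomial products are `Aₖ = (a)ₖ (1 - a)ₖ / k!²`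
(`coeffA`), up to the geometric factor absorbed in `t`, so that without harmonic weights the series
is `F(t) = ₂F₁(a, 1 - a; 1; t) = P_ν(1 - 2 t)`; this is Euler's integral, expanded by the binomial
series (`legendreP_eq_powerSum`). The weights of the first family are `hₖ = ∑_{j < k} (1 / (j + a)
+ 1 / (j + 1 - a))` (`weightS`). The two families become the single statements `seriesSum_weightS`
and `tildeEvaluation_of_coeff`, valid for every `a ∈ (0, 1)`, in which the only arithmetic input is
the value of `lim (hₖ - 2 Hₖ)`.

On `(0, 1)` everything follows from Wronskians of the hypergeometric equation `(x (1 - x) F')' = a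
(1 - a) F`. The series `S = ∑ Aₖ hₖ xᵏ` and `T = ∑ Aₖ Hₖ xᵏ` satisfy it with the inhomogeneities `2
x F' + F` and `F'`. Hence `x (1 - x) (S' F - S F') = x F²`, that is `(S / F)' = 1 / (1 - x)` and `S
= -F log (1 - x)` (`serS_eq`). Similarly `F log ((1 - x) / x) + 2 T` solves the homogeneous
equation, as does `F(1 - x)`, and their Wronskians with `F` are constant; they differ by the factor
`lim k Aₖ = sin (π a) / π`, which comes from Euler's product for the Gamma function. Therefore `(π
/ sin (π a)) F(1 - x) = F(x) (log ((1 - x) / x) + C) + 2 T(x)` with a constant `C`. Dividing by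
`F`, which diverges at `1`, and using the formula for `S`, one finds `C = lim (hₖ - 2 Hₖ)`
(`serF_one_sub_eq`).

The identities extend to the disc, or to the disc slit along `(-1, 0]`, by the identity theorem,
since Euler's integral is holomorphic off its cut. On the unit circle the series converge by
Dirichlet's test, and Abel's theorem gives their values. The point `t = -1` lies on the cut of the
closed form: there Euler's integral has one-sided limits along nontangential paths by dominated
convergence (`exists_tendsto_eulerIntegral`), and they are identified by Abel's theorem in a Stolz
cone.
-/

namespace LegendreSun

/-! ### Power series with coefficients of polynomial growth -/

section PowerSum

variable {𝕜 : Type*} [RCLike 𝕜]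

/-- The sequence `c` grows at most polynomially. The power series with such coefficients converge in
the unit disc, and the class is stable under the operations on coefficients used below. -/
def Tempered (c : ℕ → 𝕜) : Prop := ∃ (C : ℝ) (m : ℕ), ∀ k, ‖c k‖ ≤ C * ((k : ℝ) + 1) ^ m

/-- The sum of the power series with coefficients `c`. -/
noncomputable def powerSum (c : ℕ → 𝕜) (x : 𝕜) : 𝕜 := ∑' k, c k * x ^ k

lemma Tempered.add {c d : ℕ → 𝕜} (hc : Tempered c) (hd : Tempered d) :
    Tempered (fun k => c k + d k) := by
  obtain ⟨C, m, hC⟩ := hc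
  obtain ⟨D, n, hD⟩ := hd
  have hC0 : 0 ≤ C := by simpa using (norm_nonneg _).trans (hC 0)
  have hD0 : 0 ≤ D := by simpa using (norm_nonneg _).trans (hD 0)
  refine ⟨C + D, max m n, fun k => (norm_add_le _ _).trans ?_⟩
  have h1 : (1 : ℝ) ≤ (k : ℝ) + 1 := by linarith [k.cast_nonneg (α := ℝ)]
  rw [add_mul]
  refine add_le_add ((hC k).trans ?_) ((hD k).trans ?_)
  · exact mul_le_mul_of_nonneg_left (pow_le_pow_right₀ h1 (le_max_left _ _)) hC0
  · exact mul_le_mul_of_nonneg_left (pow_le_pow_right₀ h1 (le_max_right _ _)) hD0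

lemma Tempered.mul {c d : ℕ → 𝕜} (hc : Tempered c) (hd : Tempered d) :
    Tempered (fun k => c k * d k) := by
  obtain ⟨C, m, hC⟩ := hc
  obtain ⟨D, n, hD⟩ := hd
  refine ⟨C * D, m + n, fun k => ?_⟩
  rw [norm_mul, pow_add, mul_mul_mul_comm]
  exact mul_le_mul (hC k) (hD k) (norm_nonneg _) ((norm_nonneg _).trans (hC k))

lemma Tempered.of_bound {c : ℕ → 𝕜} (C : ℝ) (h : ∀ k, ‖c k‖ ≤ C) : Tempered c :=
  ⟨C, 0, fun k => by simpa using h k⟩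

lemma tempered_const (z : 𝕜) : Tempered (fun _ : ℕ => z) := .of_bound ‖z‖ fun _ => le_rfl

lemma tempered_natCast : Tempered (fun k : ℕ => (k : 𝕜)) :=
  ⟨1, 1, fun k => by simp⟩

lemma Tempered.neg {c : ℕ → 𝕜} (hc : Tempered c) : Tempered (fun k => -c k) := by
  simpa using (tempered_const (-1 : 𝕜)).mul hc

lemma Tempered.sub {c d : ℕ → 𝕜} (hc : Tempered c) (hd : Tempered d) :
    Tempered (fun k => c k - d k) := by
  simpa [sub_eq_add_neg] using hc.add hd.neg

lemma Tempered.succ {c : ℕ → 𝕜} (hc : Tempered c) : Tempered (fun k => c (k + 1)) := by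
  obtain ⟨C, m, hC⟩ := hc
  have hC0 : 0 ≤ C := by simpa using (norm_nonneg _).trans (hC 0)
  refine ⟨C * 2 ^ m, m, fun k => (hC _).trans ?_⟩
  rw [mul_assoc, ← mul_pow]
  gcongr
  push_cast
  linarith [k.cast_nonneg (α := ℝ)]

lemma Tempered.derivCoeff {c : ℕ → 𝕜} (hc : Tempered c) :
    Tempered (fun k : ℕ => ((k : 𝕜) + 1) * c (k + 1)) :=
  (tempered_natCast.add (tempered_const 1)).mul hc.succ

lemma Tempered.ofReal {c : ℕ → ℝ} (hc : Tempered c) : Tempered (fun k => (c k : ℂ)) := by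
  obtain ⟨C, m, hC⟩ := hc
  exact ⟨C, m, fun k => by simpa using hC k⟩

lemma summable_tempered_bound (C : ℝ) (m : ℕ) {r : ℝ} (h0 : 0 ≤ r) (h1 : r < 1) :
    Summable (fun k : ℕ => C * ((k : ℝ) + 1) ^ m * r ^ k) := by
  obtain ⟨s, hs, hs1⟩ := exists_between h1
  have hs0 : 0 < s := h0.trans_lt hs
  have h := summable_pow_mul_geometric_of_norm_lt_one (R := ℝ) m (r := s)
    (by rwa [Real.norm_of_nonneg hs0.le])
  have h2 := ((summable_nat_add_iff 1).2 h).mul_left (|C| / s)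
  refine Summable.of_norm_bounded h2 fun k => ?_
  have hk : (0 : ℝ) ≤ (k : ℝ) + 1 := by positivity
  rw [norm_mul, norm_mul, Real.norm_eq_abs, norm_pow, norm_pow, Real.norm_of_nonneg hk,
    Real.norm_of_nonneg h0]
  have : |C| / s * (((k + 1 : ℕ) : ℝ) ^ m * s ^ (k + 1)) = |C| * ((k : ℝ) + 1) ^ m * s ^ k := by
    push_cast; field_simp; ring
  rw [this]
  gcongr

lemma Tempered.summable {c : ℕ → 𝕜} (hc : Tempered c) {x : 𝕜} (hx : ‖x‖ < 1) :
    Summable (fun k => c k * x ^ k) := by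
  obtain ⟨C, m, hC⟩ := hc
  refine Summable.of_norm_bounded (summable_tempered_bound C m (norm_nonneg x) hx) fun k => ?_
  rw [norm_mul, norm_pow]
  gcongr
  exact hC k

lemma Tempered.hasSum {c : ℕ → 𝕜} (hc : Tempered c) {x : 𝕜} (hx : ‖x‖ < 1) :
    HasSum (fun k => c k * x ^ k) (powerSum c x) := (hc.summable hx).hasSum

lemma Tempered.hasDerivAt {c : ℕ → 𝕜} (hc : Tempered c) {x : 𝕜} (hx : ‖x‖ < 1) :
    HasDerivAt (powerSum c) (powerSum (fun k : ℕ => ((k : 𝕜) + 1) * c (k + 1)) x) x := by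
  obtain ⟨r, hxr, hr1⟩ := exists_between hx
  have hr0 : 0 < r := (norm_nonneg x).trans_lt hxr
  have hc' := hc
  obtain ⟨C, m, hC⟩ := hc
  have hC0 : 0 ≤ C := by simpa using (norm_nonneg _).trans (hC 0)
  have hu : Summable (fun k : ℕ => C / r * ((k : ℝ) + 1) ^ (m + 1) * r ^ k) :=
    summable_tempered_bound _ _ hr0.le hr1
  have key := hasDerivAt_tsum_of_isPreconnected (𝕜 := 𝕜) (y₀ := 0) (y := x)
    (g := fun k y => c k * y ^ k) (g' := fun k y => c k * ((k : 𝕜) * y ^ (k - 1))) hu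
    (Metric.isOpen_ball (x := (0 : 𝕜)) (ε := r)) (convex_ball (0 : 𝕜) r).isPreconnected
    (fun n y _ => (hasDerivAt_pow n y).const_mul (c n)) ?_ (by simpa using hr0)
    (hc'.summable (by simp)) (by simpa using hxr)
  · have hs : Summable fun k : ℕ => c k * ((k : 𝕜) * x ^ (k - 1)) := by
      rw [← summable_nat_add_iff 1]
      refine (hc'.derivCoeff.summable hx).congr fun k => ?_
      simp; ring
    have e : ∑' k : ℕ, c k * ((k : 𝕜) * x ^ (k - 1)) =
        powerSum (fun k : ℕ => ((k : 𝕜) + 1) * c (k + 1)) x := by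
      rw [hs.tsum_eq_zero_add]
      simp only [Nat.cast_zero, zero_mul, mul_zero, zero_add, Nat.add_sub_cancel, powerSum]
      exact tsum_congr fun k => by push_cast; ring
    rw [← e]
    exact key
  · intro k y hy
    have hy' : ‖y‖ ≤ r := by simpa using (Metric.mem_ball.1 hy).le
    rcases k with _ | k
    · simp; positivity
    · rw [norm_mul, norm_mul, norm_pow, RCLike.norm_natCast, Nat.add_sub_cancel]
      calc ‖c (k + 1)‖ * (((k + 1 : ℕ) : ℝ) * ‖y‖ ^ k)
          ≤ C * (((k + 1 : ℕ) : ℝ) + 1) ^ m * ((((k + 1 : ℕ) : ℝ) + 1) * r ^ k) := by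
            gcongr
            · exact hC _
            · linarith
        _ = C / r * (((k + 1 : ℕ) : ℝ) + 1) ^ (m + 1) * r ^ (k + 1) := by
            field_simp; ring

lemma powerSum_zero (c : ℕ → 𝕜) : powerSum c 0 = c 0 := by
  rw [powerSum, tsum_eq_single 0 (fun k hk => by simp [hk])]; simp

lemma mul_powerSum {c : ℕ → 𝕜} (hc : Tempered c) (hc0 : c 0 = 0) {x : 𝕜} (hx : ‖x‖ < 1) :
    x * powerSum (fun k => c (k + 1)) x = powerSum c x := by
  have h := (hc.succ.hasSum hx).mul_left x
  have h2 : HasSum (fun k => c (k + 1) * x ^ (k + 1)) (powerSum c x) := by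
    simpa [hc0] using (hasSum_nat_add_iff' 1).2 (hc.hasSum hx)
  refine h.unique (h2.congr_fun ?_)
  intro k; simp only [pow_succ]; ring

lemma powerSum_add {c d : ℕ → 𝕜} (hc : Tempered c) (hd : Tempered d) {x : 𝕜} (hx : ‖x‖ < 1) :
    powerSum (fun k => c k + d k) x = powerSum c x + powerSum d x := by
  refine ((hc.add hd).hasSum hx).unique (((hc.hasSum hx).add (hd.hasSum hx)).congr_fun ?_)
  intro k; ring

lemma powerSum_const_mul (z : 𝕜) (c : ℕ → 𝕜) (x : 𝕜) :
    powerSum (fun k => z * c k) x = z * powerSum c x := by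
  simp only [powerSum, mul_assoc, tsum_mul_left]

lemma powerSum_sub {c d : ℕ → 𝕜} (hc : Tempered c) (hd : Tempered d) {x : 𝕜} (hx : ‖x‖ < 1) :
    powerSum (fun k => c k - d k) x = powerSum c x - powerSum d x := by
  refine ((hc.sub hd).hasSum hx).unique (((hc.hasSum hx).sub (hd.hasSum hx)).congr_fun ?_)
  intro k; ring

lemma ofReal_powerSum (c : ℕ → ℝ) (x : ℝ) :
    ((powerSum c x : ℝ) : ℂ) = powerSum (fun k => (c k : ℂ)) (x : ℂ) := by
  simp [powerSum, Complex.ofReal_tsum]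

lemma Tempered.analyticOnNhd {c : ℕ → ℂ} (hc : Tempered c) :
    AnalyticOnNhd ℂ (powerSum c) (Metric.ball 0 1) := by
  refine DifferentiableOn.analyticOnNhd (fun z hz => ?_) Metric.isOpen_ball
  exact (hc.hasDerivAt (by simpa using hz)).differentiableAt.differentiableWithinAt

/-- The hypergeometric operator `f ↦ (x (1 - x) f')'` in terms of the coefficients. -/
lemma Tempered.hasDerivAt_mul_deriv {c : ℕ → 𝕜} (hc : Tempered c) {x : 𝕜} (hx : ‖x‖ < 1) :
    HasDerivAt
      (fun y => y * (1 - y) * powerSum (fun k : ℕ => ((k : 𝕜) + 1) * c (k + 1)) y)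
      (powerSum (fun k : ℕ => ((k : 𝕜) + 1) ^ 2 * c (k + 1) - k * (k + 1) * c k) x) x := by
  have hN := tempered_natCast (𝕜 := 𝕜)
  have h1 := tempered_const (1 : 𝕜)
  have d := hc.derivCoeff
  have D := (((hasDerivAt_id x).mul ((hasDerivAt_id x).const_sub 1)).mul (d.hasDerivAt hx))
  -- the power series of `x f'`, `x f''` and `x² f''`
  have e1 := mul_powerSum (hN.mul hc) (by simp) hx
  have e2 := mul_powerSum (hN.mul d) (by simp) hx
  have e3 := mul_powerSum ((hN.mul (hN.sub h1)).mul hc) (by simp) hx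
  push_cast at e1 e2 e3
  simp only [add_sub_cancel_right] at e3
  have E := powerSum_sub (d.add (hN.mul d))
    ((((hN.mul hc)).add (hN.mul hc)).add ((hN.mul (hN.sub h1)).mul hc)) hx
  rw [powerSum_add d (hN.mul d) hx, powerSum_add ((hN.mul hc).add (hN.mul hc))
    ((hN.mul (hN.sub h1)).mul hc) hx, powerSum_add (hN.mul hc) (hN.mul hc) hx] at E
  refine D.congr_deriv (Eq.symm ?_)
  have E' : powerSum (fun k : ℕ => ((k : 𝕜) + 1) ^ 2 * c (k + 1) - k * (k + 1) * c k) x =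
      powerSum (fun k : ℕ => ((k : 𝕜) + 1) * c (k + 1) + (k : 𝕜) * (((k : 𝕜) + 1) * c (k + 1)) -
        (k * c k + k * c k + k * (k - 1) * c k)) x := by
    congr 1; ext k; ring
  rw [E', E, ← e1, ← e3, ← e2]
  simp only [id, Pi.mul_apply]
  push_cast
  have e4 : powerSum (fun k : ℕ => ((k : 𝕜) + 1) * (k : 𝕜) * c (k + 1)) x =
      x * powerSum (fun k : ℕ => ((k : 𝕜) + 1) * (((k : 𝕜) + 1 + 1) * c (k + 1 + 1))) x := by
    rw [e2]; congr 1; ext k; ring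
  rw [e4]
  ring

end PowerSum

/-! ### The hypergeometric coefficients and their harmonic weights -/

/-- The coefficients `(a)ₖ (1 - a)ₖ / k!²` of `₂F₁(a, 1 - a; 1; t) = P₋ₐ(1 - 2 t)`. -/
noncomputable def coeffA (a : ℝ) (k : ℕ) : ℝ :=
  ∏ j ∈ Finset.range k, ((j + a) * (j + 1 - a) / ((j : ℝ) + 1) ^ 2)

/-- The weights `∑_{j < k} (1 / (j + a) + 1 / (j + 1 - a))`. They are the logarithmic derivative
in `ε` at `0` of `(a + ε)ₖ (1 - a + ε)ₖ`. -/
noncomputable def weightS (a : ℝ) (k : ℕ) : ℝ :=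
  ∑ j ∈ Finset.range k, (1 / ((j : ℝ) + a) + 1 / ((j : ℝ) + 1 - a))

/-- The harmonic numbers, as real numbers. -/
noncomputable def weightH (k : ℕ) : ℝ := ((harmonic k : ℚ) : ℝ)

lemma weightH_zero : weightH 0 = 0 := by simp [weightH]

lemma weightH_succ (k : ℕ) : weightH (k + 1) = weightH k + 1 / ((k : ℝ) + 1) := by
  simp [weightH, harmonic_succ]

lemma weightS_zero (a : ℝ) : weightS a 0 = 0 := by simp [weightS]

lemma coeffA_zero (a : ℝ) : coeffA a 0 = 1 := by simp [coeffA]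

section

variable {a : ℝ}

lemma coeffA_succ (k : ℕ) :
    ((k : ℝ) + 1) ^ 2 * coeffA a (k + 1) = (k + a) * (k + 1 - a) * coeffA a k := by
  rw [coeffA, Finset.prod_range_succ, ← coeffA]
  field_simp

lemma weightS_succ (ha : 0 < a) (ha1 : a < 1) (k : ℕ) :
    ((k : ℝ) + a) * (k + 1 - a) * weightS a (k + 1) =
      (k + a) * (k + 1 - a) * weightS a k + (2 * k + 1) := by
  rw [weightS, Finset.sum_range_succ, ← weightS]
  have h1 : (k : ℝ) + a ≠ 0 := by positivity
  have h2 : (k : ℝ) + 1 - a ≠ 0 := by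
    have : (0 : ℝ) ≤ k := k.cast_nonneg
    linarith
  field_simp
  ring

lemma factors_pos (ha : 0 < a) (ha1 : a < 1) (k : ℕ) : 0 < ((k : ℝ) + a) * (k + 1 - a) := by
  have : (0 : ℝ) ≤ k := k.cast_nonneg
  exact mul_pos (by linarith) (by linarith)

lemma coeffA_pos (ha : 0 < a) (ha1 : a < 1) (k : ℕ) : 0 < coeffA a k := by
  refine Finset.prod_pos fun j _ => ?_
  have := factors_pos ha ha1 j
  positivity

lemma mul_one_sub_le_quarter (a : ℝ) : a * (1 - a) ≤ 1 / 4 := by nlinarith [sq_nonneg (a - 1 / 2)]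

lemma coeffA_succ_le (ha : 0 < a) (ha1 : a < 1) (k : ℕ) : coeffA a (k + 1) ≤ coeffA a k := by
  have h := coeffA_succ (a := a) k
  have hp := coeffA_pos ha ha1 k
  have hk : (0 : ℝ) ≤ k := k.cast_nonneg
  have h2 : ((k : ℝ) + a) * (k + 1 - a) ≤ ((k : ℝ) + 1) ^ 2 := by
    nlinarith [mul_one_sub_le_quarter a]
  refine le_of_mul_le_mul_left ?_ (show (0 : ℝ) < (k + 1) ^ 2 by positivity)
  rw [h]
  exact mul_le_mul_of_nonneg_right h2 hp.le

lemma coeffA_le_one (ha : 0 < a) (ha1 : a < 1) (k : ℕ) : coeffA a k ≤ 1 := by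
  induction k with
  | zero => simp [coeffA_zero]
  | succ k ih => exact (coeffA_succ_le ha ha1 k).trans ih

lemma tempered_coeffA (ha : 0 < a) (ha1 : a < 1) : Tempered (coeffA a) :=
  .of_bound 1 fun k => by
    rw [Real.norm_of_nonneg (coeffA_pos ha ha1 k).le]; exact coeffA_le_one ha ha1 k

lemma weightH_nonneg (k : ℕ) : 0 ≤ weightH k := by
  induction k with
  | zero => simp [weightH_zero]
  | succ k ih => rw [weightH_succ]; positivity

lemma weightH_mono : Monotone weightH :=
  monotone_nat_of_le_succ fun k => by
    rw [weightH_succ]; have : (0 : ℝ) ≤ 1 / ((k : ℝ) + 1) := by positivity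
    linarith

lemma one_le_weightH {k : ℕ} (hk : 1 ≤ k) : 1 ≤ weightH k := by
  have := weightH_mono hk
  rwa [show weightH 1 = 1 by simp [weightH]] at this

lemma weightH_le (k : ℕ) : weightH k ≤ k := by
  induction k with
  | zero => simp [weightH_zero]
  | succ k ih =>
    rw [weightH_succ]; push_cast
    have : 1 / ((k : ℝ) + 1) ≤ 1 := by
      rw [div_le_one (by positivity)]; linarith [k.cast_nonneg (α := ℝ)]
    linarith

lemma tempered_weightH : Tempered weightH :=
  ⟨1, 1, fun k => by
    rw [Real.norm_of_nonneg (weightH_nonneg k)]; linarith [weightH_le k]⟩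

lemma weightS_term_nonneg (ha : 0 < a) (ha1 : a < 1) (k : ℕ) :
    0 ≤ 1 / ((k : ℝ) + a) + 1 / ((k : ℝ) + 1 - a) := by
  have : (0 : ℝ) ≤ k := k.cast_nonneg
  have h : (0 : ℝ) < k + 1 - a := by linarith
  positivity

lemma weightS_nonneg (ha : 0 < a) (ha1 : a < 1) (k : ℕ) : 0 ≤ weightS a k :=
  Finset.sum_nonneg fun j _ => weightS_term_nonneg ha ha1 j

lemma weightS_mono (ha : 0 < a) (ha1 : a < 1) : Monotone (weightS a) :=
  monotone_nat_of_le_succ fun k => by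
    rw [weightS, weightS, Finset.sum_range_succ]
    linarith [weightS_term_nonneg ha ha1 k]

/-- Termwise comparison with the harmonic numbers. -/
lemma weightS_le (ha : 0 < a) (ha1 : a < 1) (k : ℕ) :
    weightS a k ≤ (1 / a + 1 / (1 - a)) * weightH k := by
  have ha' : 0 < 1 - a := by linarith
  induction k with
  | zero => simp [weightS_zero, weightH_zero]
  | succ k ih =>
    rw [weightS, Finset.sum_range_succ, ← weightS, weightH_succ, mul_add]
    refine add_le_add ih ?_
    rw [add_mul]
    have hk : (0 : ℝ) ≤ k := k.cast_nonneg
    refine add_le_add ?_ ?_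
    · rw [div_mul_div_comm, one_mul]
      exact one_div_le_one_div_of_le (by positivity) (by nlinarith)
    · rw [div_mul_div_comm, one_mul]
      exact one_div_le_one_div_of_le (by positivity) (by nlinarith)

lemma four_le_weightS (ha : 0 < a) (ha1 : a < 1) {k : ℕ} (hk : 1 ≤ k) : 4 ≤ weightS a k := by
  refine le_trans ?_ (weightS_mono ha ha1 hk)
  have ha' : 0 < 1 - a := by linarith
  have : weightS a 1 = 1 / (a * (1 - a)) := by
    simp [weightS]; field_simp; ring
  rw [this, le_div_iff₀ (by positivity)]
  linarith [mul_one_sub_le_quarter a]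

lemma tempered_weightS (ha : 0 < a) (ha1 : a < 1) : Tempered (weightS a) := by
  have ha' : 0 < 1 - a := by linarith
  refine ⟨1 / a + 1 / (1 - a), 1, fun k => ?_⟩
  rw [Real.norm_of_nonneg (weightS_nonneg ha ha1 k)]
  refine (weightS_le ha ha1 k).trans ?_
  gcongr
  linarith [weightH_le k]

lemma coeffA_mul_weightH_succ_le (ha : 0 < a) (ha1 : a < 1) {k : ℕ} (hk : 1 ≤ k) :
    coeffA a (k + 1) * weightH (k + 1) ≤ coeffA a k * weightH k := by
  have h := coeffA_succ (a := a) k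
  have hp := coeffA_pos ha ha1 k
  have hk : (1 : ℝ) ≤ k := by exact_mod_cast hk
  have hH := one_le_weightH (by assumption : 1 ≤ k)
  refine le_of_mul_le_mul_left ?_ (show (0 : ℝ) < (k + 1) ^ 2 by positivity)
  rw [← mul_assoc, h, weightH_succ, mul_right_comm, ← mul_assoc, mul_right_comm (((k : ℝ) + 1) ^ 2)]
  refine mul_le_mul_of_nonneg_right ?_ hp.le
  have hq := mul_one_sub_le_quarter a
  have e : ((k : ℝ) + a) * (k + 1 - a) = k * (k + 1) + a * (1 - a) := by ring
  have h3 : (k * (k + 1) + a * (1 - a)) * (1 / ((k : ℝ) + 1)) ≤ k + 1 / 4 := by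
    rw [mul_one_div, div_le_iff₀ (by positivity)]; nlinarith
  rw [e, mul_add]
  nlinarith

lemma coeffA_mul_weightS_succ_le (ha : 0 < a) (ha1 : a < 1) {k : ℕ} (hk : 1 ≤ k) :
    coeffA a (k + 1) * weightS a (k + 1) ≤ coeffA a k * weightS a k := by
  have h := coeffA_succ (a := a) k
  have hp := coeffA_pos ha ha1 k
  have hk : (1 : ℝ) ≤ k := by exact_mod_cast hk
  have hS := four_le_weightS ha ha1 (by assumption : 1 ≤ k)
  refine le_of_mul_le_mul_left ?_ (show (0 : ℝ) < (k + 1) ^ 2 by positivity)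
  rw [← mul_assoc, h, mul_right_comm, weightS_succ ha ha1, ← mul_assoc,
    mul_right_comm (((k : ℝ) + 1) ^ 2)]
  refine mul_le_mul_of_nonneg_right ?_ hp.le
  nlinarith [mul_one_sub_le_quarter a]

/-- The bound holds because `k Aₖ` is nondecreasing; it makes `∑ Aₖ` diverge. -/
lemma le_natCast_mul_coeffA (ha : 0 < a) (ha1 : a < 1) (k : ℕ) :
    a * (1 - a) ≤ ((k : ℝ) + 1) * coeffA a (k + 1) := by
  have ha' : 0 < 1 - a := by linarith
  induction k with
  | zero => simp [coeffA]
  | succ k ih =>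
    refine ih.trans ?_
    have h := coeffA_succ (a := a) (k + 1)
    push_cast at h ⊢
    refine le_of_mul_le_mul_left ?_ (show (0 : ℝ) < k + 1 + 1 by positivity)
    rw [← mul_assoc, ← mul_assoc, ← sq ((k : ℝ) + 1 + 1), h]
    refine mul_le_mul_of_nonneg_right ?_ (coeffA_pos ha ha1 _).le
    nlinarith [mul_pos ha ha']

/-- By Euler's product for the Gamma function and the reflection formula, `k Aₖ → sin (π a) / π`. -/
lemma tendsto_natCast_mul_coeffA (ha : 0 < a) (ha1 : a < 1) :
    Tendsto (fun k : ℕ => ((k : ℝ) + 1) * coeffA a (k + 1)) atTop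
      (𝓝 (Real.sin (Real.pi * a) / Real.pi)) := by
  have hs : 0 < Real.sin (Real.pi * a) :=
    Real.sin_pos_of_pos_of_lt_pi (by positivity) (by nlinarith [Real.pi_pos])
  have h := (Real.GammaSeq_tendsto_Gamma a).mul (Real.GammaSeq_tendsto_Gamma (1 - a))
  rw [Real.Gamma_mul_Gamma_one_sub] at h
  have h2 := h.inv₀ (by have := Real.pi_pos; positivity)
  rw [inv_div] at h2
  have h3 : Tendsto (fun k : ℕ => (k : ℝ) / (k + 1)) atTop (𝓝 1) :=
    tendsto_natCast_div_add_atTop (1 : ℝ)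
  have h4 := h2.mul h3
  rw [mul_one] at h4
  refine h4.congr' ?_
  filter_upwards [eventually_ge_atTop 1] with n hn
  have hn' : (0 : ℝ) < n := by exact_mod_cast hn
  have hP : ∀ m : ℕ, coeffA a m * ((m.factorial : ℝ)) ^ 2 =
      (∏ j ∈ Finset.range m, (a + j)) * ∏ j ∈ Finset.range m, (1 - a + j) := by
    intro m
    rw [← Finset.prod_mul_distrib, ← Finset.prod_range_add_one_eq_factorial]
    push_cast
    rw [coeffA, ← Finset.prod_pow, ← Finset.prod_mul_distrib]
    refine Finset.prod_congr rfl fun j _ => ?_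
    have : (j : ℝ) + 1 ≠ 0 := by positivity
    field_simp
    ring
  have e : Real.GammaSeq a n * Real.GammaSeq (1 - a) n =
      (n : ℝ) * (n.factorial : ℝ) ^ 2 / (coeffA a (n + 1) * ((n + 1).factorial : ℝ) ^ 2) := by
    rw [hP, Real.GammaSeq, Real.GammaSeq, div_mul_div_comm]
    congr 1
    rw [mul_mul_mul_comm, ← Real.rpow_add hn', sq]
    norm_num
  rw [e, Nat.factorial_succ]
  have := (coeffA_pos ha ha1 (n + 1)).ne'
  have := n.factorial_pos
  push_cast
  field_simp

lemma tendsto_coeffA_mul_weightH (ha : 0 < a) (ha1 : a < 1) :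
    Tendsto (fun k => coeffA a k * weightH k) atTop (𝓝 0) := by
  rw [← tendsto_add_atTop_iff_nat 1]
  -- `Hₖ / k → 0`, because `Hₖ - log k` converges
  have h1 : Tendsto (fun k : ℕ => weightH k / k) atTop (𝓝 0) := by
    have h := (Real.tendsto_harmonic_sub_log.div_atTop (tendsto_natCast_atTop_atTop (R := ℝ))).add
      ((Real.isLittleO_log_id_atTop.tendsto_div_nhds_zero).comp
        (tendsto_natCast_atTop_atTop (R := ℝ)))
    rw [add_zero] at h
    refine h.congr fun k => ?_
    simp only [Function.comp, id, weightH]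
    ring
  have h2 := (tendsto_natCast_mul_coeffA ha ha1).mul ((tendsto_add_atTop_iff_nat 1).2 h1)
  rw [mul_zero] at h2
  refine h2.congr fun k => ?_
  push_cast
  field_simp

lemma tendsto_coeffA_mul_weightS (ha : 0 < a) (ha1 : a < 1) :
    Tendsto (fun k => coeffA a k * weightS a k) atTop (𝓝 0) := by
  have h := (tendsto_coeffA_mul_weightH ha ha1).const_mul (1 / a + 1 / (1 - a))
  rw [mul_zero] at h
  refine squeeze_zero (fun k => mul_nonneg (coeffA_pos ha ha1 k).le (weightS_nonneg ha ha1 k))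
    (fun k => ?_) h
  have := mul_le_mul_of_nonneg_left (weightS_le ha ha1 k) (coeffA_pos ha ha1 k).le
  linarith

end

/-! ### Abelian limits at the point `1` -/

/-- A power series with nonnegative coefficients of divergent sum tends to infinity at `1`. -/
lemma tendsto_powerSum_atTop {u : ℕ → ℝ} (hu : Tempered u) (h0 : ∀ k, 0 ≤ u k)
    (hs : ¬ Summable u) : Tendsto (powerSum u) (𝓝[<] 1) atTop := by
  have h := (not_summable_iff_tendsto_nat_atTop_of_nonneg h0).1 hs
  rw [tendsto_atTop]
  intro B
  obtain ⟨N, hN⟩ := (h.eventually_gt_atTop B).exists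
  have hc : ContinuousAt (fun x : ℝ => ∑ k ∈ Finset.range N, u k * x ^ k) 1 := by fun_prop
  have h1 : ∀ᶠ x in 𝓝[<] (1 : ℝ), B < ∑ k ∈ Finset.range N, u k * x ^ k :=
    (hc.eventually (lt_mem_nhds (by simpa using hN))).filter_mono nhdsWithin_le_nhds
  filter_upwards [h1, Ioo_mem_nhdsLT (zero_lt_one' ℝ)] with x hx hx1
  refine hx.le.trans ?_
  have hx' : ‖x‖ < 1 := by rw [Real.norm_of_nonneg hx1.1.le]; exact hx1.2
  exact (hu.summable hx').sum_le_tsum _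
    fun k _ => mul_nonneg (h0 k) (pow_nonneg hx1.1.le k)

/-- A weighted mean of a convergent sequence, with weights `uₖ xᵏ` whose sum diverges as `x → 1`,
tends to the limit of the sequence. -/
lemma tendsto_powerSum_div {u d : ℕ → ℝ} (hu : Tempered u) (h0 : ∀ k, 0 ≤ u k)
    (hs : ¬ Summable u) (hd : Tempered d) {l : ℝ} (hl : Tendsto d atTop (𝓝 l)) :
    Tendsto (fun x => powerSum (fun k => u k * d k) x / powerSum u x) (𝓝[<] 1) (𝓝 l) := by
  have hU := tendsto_powerSum_atTop hu h0 hs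
  rw [Metric.tendsto_nhds]
  intro ε hε
  obtain ⟨N, hN⟩ := (Metric.tendsto_atTop.1 hl) (ε / 2) (by positivity)
  -- the first `N` terms contribute at most `B`, which is negligible against the divergent weights
  set B : ℝ := ∑ k ∈ Finset.range N, u k * |d k - l| with hB
  filter_upwards [hU.eventually_gt_atTop (max 0 (B / (ε / 2))), Ioo_mem_nhdsLT (zero_lt_one' ℝ)]
    with x hx hx1
  have hx' : ‖x‖ < 1 := by rw [Real.norm_of_nonneg hx1.1.le]; exact hx1.2
  have hpos : 0 < powerSum u x := (le_max_left _ _).trans_lt hx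
  have hBx : B < powerSum u x * (ε / 2) := by
    have := (le_max_right _ _).trans_lt hx
    rwa [div_lt_iff₀ (by positivity)] at this
  have hv : Tempered fun k => u k * (d k - l) := hu.mul (hd.sub (tempered_const l))
  have e : powerSum (fun k => u k * d k) x - l * powerSum u x =
      powerSum (fun k => u k * (d k - l)) x := by
    rw [← powerSum_const_mul, ← powerSum_sub (hu.mul hd) ((tempered_const l).mul hu) hx']
    congr 1; ext k; ring
  rw [Real.dist_eq, div_sub' hpos.ne', abs_div, abs_of_pos hpos, div_lt_iff₀ hpos,
    mul_comm (powerSum u x), e]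
  have hbnd : |powerSum (fun k => u k * (d k - l)) x| ≤ B + ε / 2 * powerSum u x := by
    have s1 := (hv.summable hx').norm
    have hle : ∀ k, ‖u k * (d k - l) * x ^ k‖ ≤
        (if k ∈ Finset.range N then u k * |d k - l| else 0) + ε / 2 * (u k * x ^ k) := by
      intro k
      have hxk : 0 ≤ x ^ k := pow_nonneg hx1.1.le k
      have hxk1 : x ^ k ≤ 1 := pow_le_one₀ hx1.1.le hx1.2.le
      rw [norm_mul, norm_mul, Real.norm_of_nonneg (h0 k), Real.norm_of_nonneg hxk,
        Real.norm_eq_abs]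
      have hp : 0 ≤ ε / 2 * (u k * x ^ k) := by have := h0 k; positivity
      split_ifs with hk
      · have := mul_le_mul_of_nonneg_left hxk1 (mul_nonneg (h0 k) (abs_nonneg (d k - l)))
        linarith
      · have h2 : |d k - l| ≤ ε / 2 := by
          have := hN k (by simpa using hk)
          rw [Real.dist_eq] at this
          exact this.le
        have := mul_le_mul_of_nonneg_left h2 (mul_nonneg (h0 k) hxk)
        linarith
    have hfin : HasSum (fun k => if k ∈ Finset.range N then u k * |d k - l| else 0) B := by
      have : B = ∑ k ∈ Finset.range N,
          if k ∈ Finset.range N then u k * |d k - l| else 0 :=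
        Finset.sum_congr rfl fun k hk => by rw [if_pos hk]
      rw [this]
      exact hasSum_sum_of_ne_finset_zero fun k hk => by rw [if_neg hk]
    have htot := hfin.add ((hu.hasSum hx').mul_left (ε / 2))
    calc |powerSum (fun k => u k * (d k - l)) x| ≤ ∑' k, ‖u k * (d k - l) * x ^ k‖ :=
          norm_tsum_le_tsum_norm s1
      _ ≤ _ := (s1.tsum_le_tsum hle htot.summable).trans htot.tsum_eq.le
  linarith

/-- Abel's theorem in the form `(1 - x) ∑ uₖ xᵏ → lim uₖ`. -/
lemma tendsto_one_sub_mul_powerSum {d : ℕ → ℝ} (hd : Tempered d) {l : ℝ}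
    (hl : Tendsto d atTop (𝓝 l)) :
    Tendsto (fun x => (1 - x) * powerSum d x) (𝓝[<] 1) (𝓝 l) := by
  have hs : ¬ Summable (fun _ : ℕ => (1 : ℝ)) := fun h => by
    simpa using tendsto_nhds_unique h.tendsto_atTop_zero tendsto_const_nhds
  have h := tendsto_powerSum_div (tempered_const 1) (fun _ => zero_le_one) hs hd hl
  refine h.congr' ?_
  filter_upwards [Ioo_mem_nhdsLT (zero_lt_one' ℝ)] with x hx
  simp only [powerSum, one_mul]
  rw [tsum_geometric_of_lt_one hx.1.le hx.2, div_inv_eq_mul, mul_comm]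

/-! ### The identities on the interval `(0, 1)` -/

lemma eq_of_hasDerivAt_zero {f : ℝ → ℝ} {x y : ℝ} (hxy : x ≤ y)
    (h : ∀ z ∈ Set.Icc x y, HasDerivAt f 0 z) : f y = f x :=
  constant_of_has_deriv_right_zero (fun z hz => (h z hz).continuousAt.continuousWithinAt)
    (fun z hz => (h z ⟨hz.1, hz.2.le⟩).hasDerivWithinAt) y ⟨hxy, le_rfl⟩

section

variable (a : ℝ)

/-- `F(x) = ∑ Aₖ xᵏ`. -/
noncomputable def serF : ℝ → ℝ := powerSum (coeffA a)

/-- The derivative of `F`. -/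
noncomputable def serF' : ℝ → ℝ := powerSum fun k : ℕ => ((k : ℝ) + 1) * coeffA a (k + 1)

/-- `T(x) = ∑ Aₖ Hₖ xᵏ`. -/
noncomputable def serT : ℝ → ℝ := powerSum fun k => coeffA a k * weightH k

/-- The derivative of `T`. -/
noncomputable def serT' : ℝ → ℝ :=
  powerSum fun k : ℕ => ((k : ℝ) + 1) * (coeffA a (k + 1) * weightH (k + 1))

/-- `S(x) = ∑ Aₖ hₖ xᵏ` with the weights `hₖ` of `weightS`. -/
noncomputable def serS : ℝ → ℝ := powerSum fun k => coeffA a k * weightS a k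

/-- The derivative of `S`. -/
noncomputable def serS' : ℝ → ℝ :=
  powerSum fun k : ℕ => ((k : ℝ) + 1) * (coeffA a (k + 1) * weightS a (k + 1))

end

section

variable {a : ℝ} (ha : 0 < a) (ha1 : a < 1)
include ha ha1

lemma tempered_T : Tempered fun k => coeffA a k * weightH k :=
  (tempered_coeffA ha ha1).mul tempered_weightH

lemma tempered_S : Tempered fun k => coeffA a k * weightS a k :=
  (tempered_coeffA ha ha1).mul (tempered_weightS ha ha1)

lemma hasDerivAt_serF {x : ℝ} (hx : ‖x‖ < 1) : HasDerivAt (serF a) (serF' a x) x :=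
  (tempered_coeffA ha ha1).hasDerivAt hx

lemma hasDerivAt_serT {x : ℝ} (hx : ‖x‖ < 1) : HasDerivAt (serT a) (serT' a x) x :=
  (tempered_T ha ha1).hasDerivAt hx

lemma hasDerivAt_serS {x : ℝ} (hx : ‖x‖ < 1) : HasDerivAt (serS a) (serS' a x) x :=
  (tempered_S ha ha1).hasDerivAt hx

/-- The hypergeometric equation `(x (1 - x) F')' = a (1 - a) F`. -/
lemma ode_serF {x : ℝ} (hx : ‖x‖ < 1) :
    HasDerivAt (fun y => y * (1 - y) * serF' a y) (a * (1 - a) * serF a x) x := by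
  refine ((tempered_coeffA ha ha1).hasDerivAt_mul_deriv hx).congr_deriv ?_
  rw [serF, ← powerSum_const_mul]
  congr 1; ext k
  rw [coeffA_succ]; ring

/-- `(x (1 - x) T')' = a (1 - a) T + F'`. -/
lemma ode_serT {x : ℝ} (hx : ‖x‖ < 1) :
    HasDerivAt (fun y => y * (1 - y) * serT' a y) (a * (1 - a) * serT a x + serF' a x) x := by
  refine ((tempered_T ha ha1).hasDerivAt_mul_deriv hx).congr_deriv ?_
  rw [serF', serT, ← powerSum_const_mul, ← powerSum_add ((tempered_const _).mul (tempered_T ha ha1))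
    (tempered_coeffA ha ha1).derivCoeff hx]
  congr 1; ext k
  have h : ((k : ℝ) + 1) * (((k : ℝ) + 1) * coeffA a (k + 1)) = _ :=
    (by ring : _ = _).trans (coeffA_succ (a := a) k)
  have h1 : ((k : ℝ) + 1) * (1 / ((k : ℝ) + 1)) = 1 := by field_simp
  rw [weightH_succ]
  linear_combination weightH k * h + ((k : ℝ) + 1) * coeffA a (k + 1) * h1

/-- `(x (1 - x) S')' = a (1 - a) S + 2 x F' + F`. -/
lemma ode_serS {x : ℝ} (hx : ‖x‖ < 1) :
    HasDerivAt (fun y => y * (1 - y) * serS' a y)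
      (a * (1 - a) * serS a x + (2 * (x * serF' a x) + serF a x)) x := by
  refine ((tempered_S ha ha1).hasDerivAt_mul_deriv hx).congr_deriv ?_
  have tA := tempered_coeffA ha ha1
  have tS := tempered_S ha ha1
  have t2 := tempered_const (2 : ℝ)
  have tk := tempered_natCast (𝕜 := ℝ)
  have e := mul_powerSum (tk.mul tA) (by simp) hx
  push_cast at e
  rw [serF', e, serS, serF, ← powerSum_const_mul, ← powerSum_const_mul,
    ← powerSum_add (t2.mul (tk.mul tA)) tA hx,
    ← powerSum_add ((tempered_const _).mul tS) ((t2.mul (tk.mul tA)).add tA) hx]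
  congr 1; ext k
  linear_combination weightS a (k + 1) * coeffA_succ (a := a) k +
    coeffA a k * weightS_succ ha ha1 k

lemma one_le_serF {x : ℝ} (h0 : 0 ≤ x) (h1 : x < 1) : 1 ≤ serF a x := by
  have hx : ‖x‖ < 1 := by rwa [Real.norm_of_nonneg h0]
  have h := ((tempered_coeffA ha ha1).summable hx).sum_le_tsum (Finset.range 1)
    fun k _ => mul_nonneg (coeffA_pos ha ha1 k).le (pow_nonneg h0 k)
  simpa [coeffA_zero, serF, powerSum] using h

omit ha ha1 in
lemma serF_zero : serF a 0 = 1 := by rw [serF, powerSum_zero, coeffA_zero]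

/-- The identity for the weights `weightS`: since `x (1 - x) (S' F - S F') = x F²`, the quotient
`S / F` has the derivative `1 / (1 - x)`. -/
lemma serS_eq {x : ℝ} (h0 : 0 ≤ x) (h1 : x < 1) : serS a x = -(serF a x * Real.log (1 - x)) := by
  have key : ∀ y, 0 ≤ y → y < 1 →
      (1 - y) * (serS' a y * serF a y - serS a y * serF' a y) = serF a y ^ 2 := by
    intro y hy0 hy1
    -- the factor `y` of the Wronskian identity cannot be cancelled at `0`
    rcases hy0.eq_or_lt with rfl | hy
    · rw [serF_zero, serS, serS', powerSum_zero, powerSum_zero, weightS_zero]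
      have e1 := coeffA_succ (a := a) 0
      have e2 := weightS_succ ha ha1 0
      rw [weightS_zero] at e2
      rw [coeffA_zero] at e1
      norm_num at e1 e2 ⊢
      rw [e1, e2]
    · have h := eq_of_hasDerivAt_zero (f := fun z => z * (1 - z) * serS' a z * serF a z -
        serS a z * (z * (1 - z) * serF' a z) - z * serF a z ^ 2) hy0 ?_
      · simp only [zero_mul, mul_zero, sub_zero] at h
        have h' : y * ((1 - y) * (serS' a y * serF a y - serS a y * serF' a y) -
            serF a y ^ 2) = 0 := by
          linear_combination h
        rcases mul_eq_zero.1 h' with h' | h'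
        · exact absurd h' hy.ne'
        · linarith
      · intro z hz
        have hz' : ‖z‖ < 1 := by rw [Real.norm_of_nonneg hz.1]; exact hz.2.trans_lt hy1
        have hF := hasDerivAt_serF ha ha1 hz'
        refine ((((ode_serS ha ha1 hz').mul hF).sub
          ((hasDerivAt_serS ha ha1 hz').mul (ode_serF ha ha1 hz'))).sub
          ((hasDerivAt_id z).mul (hF.pow 2))).congr_deriv ?_
        simp
        ring
  have h := eq_of_hasDerivAt_zero (f := fun z => serS a z / serF a z + Real.log (1 - z)) h0 ?_
  · have hF := one_le_serF ha ha1 h0 h1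
    have h2 : serS a 0 = 0 := by rw [serS, powerSum_zero, weightS_zero, mul_zero]
    simp only [h2, zero_div, sub_zero, Real.log_one, add_zero] at h
    have hF' : serF a x ≠ 0 := by positivity
    field_simp at h
    linarith
  · intro z hz
    have hz1 := hz.2.trans_lt h1
    have hz' : ‖z‖ < 1 := by rw [Real.norm_of_nonneg hz.1]; exact hz1
    have hF := one_le_serF ha ha1 hz.1 hz1
    have hF' : serF a z ≠ 0 := by positivity
    have hz2 : 1 - z ≠ 0 := by linarith
    refine (((hasDerivAt_serS ha ha1 hz').div (hasDerivAt_serF ha ha1 hz') hF').add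
      (((hasDerivAt_id z).const_sub 1).log hz2)).congr_deriv ?_
    rw [eq_div_of_mul_eq hz2 ((mul_comm _ _).trans (key z hz.1 hz1))]
    simp only [id]
    field_simp
    ring

/-- `2 x (1 - x) (T' F - T F') = F² - 1`. -/
lemma wronskian_serT {x : ℝ} (h0 : 0 ≤ x) (h1 : x < 1) :
    2 * (x * (1 - x) * serT' a x) * serF a x - 2 * serT a x * (x * (1 - x) * serF' a x) =
      serF a x ^ 2 - 1 := by
  have h := eq_of_hasDerivAt_zero (f := fun z => 2 * (z * (1 - z) * serT' a z) * serF a z -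
    2 * serT a z * (z * (1 - z) * serF' a z) - serF a z ^ 2) h0 ?_
  · simp only [serF_zero] at h
    linear_combination h
  · intro z hz
    have hz' : ‖z‖ < 1 := by rw [Real.norm_of_nonneg hz.1]; exact hz.2.trans_lt h1
    have hF := hasDerivAt_serF ha ha1 hz'
    refine (((((ode_serT ha ha1 hz').const_mul 2).mul hF).sub
      (((hasDerivAt_serT ha ha1 hz').const_mul 2).mul (ode_serF ha ha1 hz'))).sub
      (hF.pow 2)).congr_deriv ?_
    simp
    ring

lemma not_summable_coeffA : ¬ Summable (coeffA a) := by
  intro h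
  have ha' : 0 < a * (1 - a) := mul_pos ha (by linarith)
  refine Real.not_summable_one_div_natCast ((summable_nat_add_iff 1).1 ?_)
  refine Summable.of_nonneg_of_le (fun k => by positivity) (fun k => ?_)
    (((summable_nat_add_iff 1).2 h).mul_left (1 / (a * (1 - a))))
  have := le_natCast_mul_coeffA ha ha1 k
  push_cast
  rw [div_mul_eq_mul_div, one_mul, div_le_div_iff₀ (by positivity) ha']
  linarith

lemma tendsto_serF_atTop : Tendsto (serF a) (𝓝[<] 1) atTop :=
  tendsto_powerSum_atTop (tempered_coeffA ha ha1) (fun k => (coeffA_pos ha ha1 k).le)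
    (not_summable_coeffA ha ha1)

omit ha ha1 in
lemma tendsto_one_sub_nhdsGT : Tendsto (fun x : ℝ => 1 - x) (𝓝[>] 0) (𝓝[<] 1) := by
  refine tendsto_nhdsWithin_iff.2 ⟨?_, ?_⟩
  · have : ContinuousAt (fun x : ℝ => 1 - x) 0 := by fun_prop
    simpa using this.tendsto.mono_left nhdsWithin_le_nhds
  · filter_upwards [self_mem_nhdsWithin] with x hx
    simpa using hx

/-- The Wronskian of `F(1 - x)` and `F(x)`. Its constant value is found as `x → 0`. -/
lemma wronskian_reflection {x : ℝ} (h0 : 0 < x) (h1 : x < 1) :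
    ((1 - x) * x * serF' a (1 - x)) * serF a x + serF a (1 - x) * (x * (1 - x) * serF' a x) =
      Real.sin (Real.pi * a) / Real.pi := by
  set w : ℝ → ℝ := fun z => ((1 - z) * (1 - (1 - z)) * serF' a (1 - z)) * serF a z +
    serF a (1 - z) * (z * (1 - z) * serF' a z) with hw
  have hconst : ∀ y, 0 < y → y ≤ x → w x = w y := by
    intro y hy hyx
    refine eq_of_hasDerivAt_zero hyx fun z hz => ?_
    have hz0 : 0 < z := hy.trans_le hz.1
    have hz1 : z < 1 := hz.2.trans_lt h1
    have hz' : ‖z‖ < 1 := by rw [Real.norm_of_nonneg hz0.le]; exact hz1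
    have hz'' : ‖1 - z‖ < 1 := by rw [Real.norm_of_nonneg (by linarith)]; linarith
    have hr : HasDerivAt (fun z : ℝ => 1 - z) (-1) z := by
      simpa using (hasDerivAt_id z).const_sub 1
    have hF := hasDerivAt_serF ha ha1 hz'
    have d1 := HasDerivAt.comp (h := fun z : ℝ => 1 - z) z (ode_serF ha ha1 hz'') hr
    have d2 := HasDerivAt.comp (h := fun z : ℝ => 1 - z) z (hasDerivAt_serF ha ha1 hz'') hr
    refine ((d1.mul hF).add (d2.mul (ode_serF ha ha1 hz'))).congr_deriv ?_
    simp
    ring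
  have hlim : Tendsto w (𝓝[>] 0) (𝓝 (Real.sin (Real.pi * a) / Real.pi)) := by
    have tA := tempered_coeffA ha ha1
    -- only the first term survives: `(1 - y) F'(y) → lim k Aₖ` and `(1 - y) F(y) → 0` as `y → 1`
    have t1 := (tendsto_one_sub_mul_powerSum tA.derivCoeff
      (tendsto_natCast_mul_coeffA ha ha1)).comp tendsto_one_sub_nhdsGT
    have hA0 : Tendsto (coeffA a) atTop (𝓝 0) := by
      rw [← tendsto_add_atTop_iff_nat 1]
      have := (tendsto_natCast_mul_coeffA ha ha1).mul
        (tendsto_one_div_add_atTop_nhds_zero_nat (𝕜 := ℝ))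
      rw [mul_zero] at this
      refine this.congr fun k => ?_
      field_simp
    have t2 := (tendsto_one_sub_mul_powerSum tA hA0).comp tendsto_one_sub_nhdsGT
    have hid : Tendsto (fun z : ℝ => z) (𝓝[>] 0) (𝓝 0) :=
      tendsto_nhdsWithin_of_tendsto_nhds tendsto_id
    have hone : Tendsto (fun z : ℝ => 1 - z) (𝓝[>] 0) (𝓝 1) := by
      simpa using hid.const_sub 1
    have c1 : Tendsto (serF a) (𝓝[>] 0) (𝓝 1) := by
      have := (hasDerivAt_serF ha ha1 (x := 0) (by simp)).continuousAt.tendsto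
      rw [serF_zero] at this
      exact this.mono_left nhdsWithin_le_nhds
    have c2 : Tendsto (serF' a) (𝓝[>] 0) (𝓝 (serF' a 0)) :=
      (tA.derivCoeff.hasDerivAt (x := (0 : ℝ)) (by simp)).continuousAt.tendsto.mono_left
        nhdsWithin_le_nhds
    have h := ((hone.mul t1).mul c1).add ((t2.mul hone).mul c2)
    simp only [one_mul, mul_one, zero_mul, add_zero] at h
    refine h.congr fun z => ?_
    simp only [hw, Function.comp, serF, serF']
    ring
  have : w x = Real.sin (Real.pi * a) / Real.pi := by
    refine tendsto_nhds_unique (tendsto_const_nhds.congr' ?_) hlim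
    filter_upwards [Ioc_mem_nhdsGT h0] with y hy
    exact hconst y hy.1 hy.2
  rw [← this, hw]
  ring

/-- The connection formula between the solutions at `0` and at `1` of the hypergeometric equation.
Both `F(1 - x) / F(x)` and `log ((1 - x) / x) + 2 T(x) / F(x)` have a derivative proportional to
`1 / (x (1 - x) F(x)²)`; the constant of integration is read off as `x → 1`, where `F` diverges. -/
lemma serF_one_sub_eq {C : ℝ} (hC : Tendsto (fun k => weightS a k - 2 * weightH k) atTop (𝓝 C))
    {x : ℝ} (h0 : 0 < x) (h1 : x < 1) :
    serF a (1 - x) = Real.sin (Real.pi * a) / Real.pi *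
      (serF a x * (Real.log (1 - x) - Real.log x + C) + 2 * serT a x) := by
  set s := Real.sin (Real.pi * a) / Real.pi with hs
  set D : ℝ → ℝ := fun z => serF a (1 - z) / serF a z -
    s * (Real.log (1 - z) - Real.log z + 2 * serT a z / serF a z) with hD
  have hconst : ∀ y, x ≤ y → y < 1 → D y = D x := by
    intro y hxy hy
    refine eq_of_hasDerivAt_zero hxy fun z hz => ?_
    have hz0 : 0 < z := h0.trans_le hz.1
    have hz1 : z < 1 := hz.2.trans_lt hy
    have hz' : ‖z‖ < 1 := by rw [Real.norm_of_nonneg hz0.le]; exact hz1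
    have hz'' : ‖1 - z‖ < 1 := by rw [Real.norm_of_nonneg (by linarith)]; linarith
    have hr : HasDerivAt (fun z : ℝ => 1 - z) (-1) z := by
      simpa using (hasDerivAt_id z).const_sub 1
    have hz2 : 1 - z ≠ 0 := by linarith
    have hF := hasDerivAt_serF ha ha1 hz'
    have hF1 : serF a z ≠ 0 := by have := one_le_serF ha ha1 hz0.le hz1; positivity
    have d2 := HasDerivAt.comp (h := fun z : ℝ => 1 - z) z (hasDerivAt_serF ha ha1 hz'') hr
    refine ((d2.div hF hF1).sub ((((hr.log hz2).sub (Real.hasDerivAt_log hz0.ne')).add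
      (((hasDerivAt_serT ha ha1 hz').const_mul 2).div hF hF1)).const_mul s)).congr_deriv ?_
    have w1 := wronskian_reflection ha ha1 hz0 hz1
    have w2 := wronskian_serT ha ha1 hz0.le hz1
    rw [← hs] at w1
    simp only [Function.comp]
    have hz3 := hz0.ne'
    field_simp
    linear_combination (-1) * w1 - s * w2
  have hlim : Tendsto D (𝓝[<] 1) (𝓝 (s * C)) := by
    have hF := tendsto_serF_atTop ha ha1
    have c1 : Tendsto (fun z => serF a (1 - z)) (𝓝[<] 1) (𝓝 1) := by
      have h := (hasDerivAt_serF ha ha1 (x := 0) (by simp)).continuousAt.tendsto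
      rw [serF_zero] at h
      refine h.comp ?_
      have : ContinuousAt (fun x : ℝ => 1 - x) 1 := by fun_prop
      simpa using this.tendsto.mono_left (nhdsWithin_le_nhds (s := Set.Iio (1 : ℝ)))
    have c2 : Tendsto Real.log (𝓝[<] 1) (𝓝 0) := by
      simpa using (Real.continuousAt_log one_ne_zero).tendsto.mono_left
        (nhdsWithin_le_nhds (s := Set.Iio (1 : ℝ)))
    have tA := tempered_coeffA ha ha1
    have c3 := tendsto_powerSum_div tA (fun k => (coeffA_pos ha ha1 k).le)
      (not_summable_coeffA ha ha1)
      ((tempered_weightS ha ha1).sub ((tempered_const 2).mul tempered_weightH)) hC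
    have h := (c1.div_atTop hF).sub (((c3.neg).sub c2).const_mul s)
    rw [show (0 : ℝ) - s * (-C - 0) = s * C by ring] at h
    refine h.congr' ?_
    filter_upwards [Ioo_mem_nhdsLT (zero_lt_one' ℝ)] with z hz
    have hz' : ‖z‖ < 1 := by rw [Real.norm_of_nonneg hz.1.le]; exact hz.2
    have hF1 : serF a z ≠ 0 := by have := one_le_serF ha ha1 hz.1.le hz.2; positivity
    -- `F log (1 - z) + 2 T = -∑ Aₖ (hₖ - 2 Hₖ) zᵏ`, to be divided by `F`
    have e1 : Real.log (1 - z) = -serS a z / serF a z := by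
      rw [serS_eq ha ha1 hz.1.le hz.2]; field_simp
    have e2 : powerSum (fun k => coeffA a k * (weightS a k - 2 * weightH k)) z =
        serS a z - 2 * serT a z := by
      rw [serS, serT, ← powerSum_const_mul, ← powerSum_sub (tempered_S ha ha1)
        ((tempered_const 2).mul (tempered_T ha ha1)) hz']
      congr 1; ext k; ring
    rw [e2, hD]
    simp only [e1]
    rw [← serF]
    field_simp
    ring
  have hDx : D x = s * C := by
    refine tendsto_nhds_unique (tendsto_const_nhds.congr' ?_) hlim
    filter_upwards [Ioo_mem_nhdsLT h1] with y hy
    exact (hconst y hy.1.le hy.2).symm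
  have hF1 : serF a x ≠ 0 := by have := one_le_serF ha ha1 h0.le h1; positivity
  rw [hD] at hDx
  simp only at hDx
  rw [sub_eq_iff_eq_add, div_eq_iff hF1] at hDx
  rw [hDx]
  field_simp
  ring

end

open MeasureTheory

/-! ### Euler's integral -/

/-- The weight `X⁻ᵃ (1 - X)ᵃ⁻¹` of Euler's integral. -/
noncomputable def eulerWeight (a X : ℝ) : ℝ := X ^ (-a) * (1 - X) ^ (a - 1)

/-- Euler's integral `∫₀¹ X⁻ᵃ (1 - X)ᵃ⁻¹ (1 - t X)⁻ᵃ dX`. -/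
noncomputable def eulerIntegral (a : ℝ) (t : ℂ) : ℂ :=
  ∫ X in Set.Ioo (0 : ℝ) 1, (eulerWeight a X : ℂ) * (1 - t * (X : ℂ)) ^ (-a : ℂ)

lemma ofReal_mul_cpow {r ν : ℝ} (hr : 0 < r) (hν : ν ≠ 0) (z : ℂ) :
    ((r : ℂ) * z) ^ (ν : ℂ) = ((r ^ ν : ℝ) : ℂ) * z ^ (ν : ℂ) := by
  have hν' : (ν : ℂ) ≠ 0 := by exact_mod_cast hν
  rcases eq_or_ne z 0 with rfl | hz
  · simp [hν']
  · have hr' : (r : ℂ) ≠ 0 := by exact_mod_cast hr.ne'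
    rw [Complex.cpow_def_of_ne_zero (mul_ne_zero hr' hz), Complex.cpow_def_of_ne_zero hz,
      Complex.log_ofReal_mul hr hz, add_mul, Complex.exp_add, Complex.ofReal_cpow hr.le,
      Complex.cpow_def_of_ne_zero hr', Complex.ofReal_log hr.le]

lemma eulerWeight_nonneg (a : ℝ) {X : ℝ} (hX : X ∈ Set.Ioo (0 : ℝ) 1) : 0 ≤ eulerWeight a X :=
  mul_nonneg (Real.rpow_nonneg hX.1.le _) (Real.rpow_nonneg (by linarith [hX.2]) _)

lemma measurable_eulerWeight (a : ℝ) : Measurable (eulerWeight a) := by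
  unfold eulerWeight; fun_prop

lemma measurable_one_sub_mul_cpow (t s : ℂ) :
    Measurable fun X : ℝ => (1 - t * (X : ℂ)) ^ s := by
  fun_prop

section

variable {a : ℝ} (ha : 0 < a) (ha1 : a < 1)
include ha ha1

omit ha1 in
lemma legendreP_eq_eulerIntegral (t : ℂ) :
    legendreP (-a) (1 - 2 * t) =
      ((Real.sin (Real.pi * a) / Real.pi : ℝ) : ℂ) * eulerIntegral a t := by
  rw [legendreP, eulerIntegral, intervalIntegral.integral_of_le zero_le_one,
    integral_Ioc_eq_integral_Ioo, neg_mul a, Real.sin_neg, neg_div, Complex.ofReal_neg, neg_neg,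
    mul_comm a]
  congr 1
  refine setIntegral_congr_fun measurableSet_Ioo fun X hX => ?_
  have h1 : 0 < 1 - X := by linarith [hX.2]
  have h1' : (1 : ℂ) - X ≠ 0 := by exact_mod_cast h1.ne'
  have e : (X : ℂ) * (1 - (1 - (1 - 2 * t)) / 2 * (X : ℂ)) / (1 - (X : ℂ)) =
      ((X / (1 - X) : ℝ) : ℂ) * (1 - t * X) := by
    push_cast; field_simp; ring
  rw [e, ofReal_mul_cpow (div_pos hX.1 h1) (neg_ne_zero.2 ha.ne'), eulerWeight,
    Real.div_rpow hX.1.le h1.le, Real.rpow_sub_one h1.ne', Real.rpow_neg h1.le]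
  push_cast
  field_simp

omit ha ha1 in
/-- The integrand of the Beta integral `B(k + 1 - a, a)`. -/
lemma ofReal_eulerWeight_mul_pow {X : ℝ} (hX : X ∈ Set.Ioo (0 : ℝ) 1) (k : ℕ) :
    ((eulerWeight a X * X ^ k : ℝ) : ℂ) =
      (X : ℂ) ^ (((k : ℂ) + 1 - a) - 1) * (1 - (X : ℂ)) ^ ((a : ℂ) - 1) := by
  have h1 : 0 ≤ 1 - X := by linarith [hX.2]
  have e : (((k : ℂ) + 1 - a) - 1) = ((-a + k : ℝ) : ℂ) := by push_cast; ring
  have e2 : (a : ℂ) - 1 = ((a - 1 : ℝ) : ℂ) := by push_cast; ring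
  have e3 : (1 : ℂ) - X = ((1 - X : ℝ) : ℂ) := by push_cast; ring
  rw [e, e2, e3, ← Complex.ofReal_cpow hX.1.le, ← Complex.ofReal_cpow h1, ← Complex.ofReal_mul,
    Real.rpow_add_natCast hX.1.ne', eulerWeight]
  congr 1; ring

lemma integrableOn_eulerWeight_mul_pow (k : ℕ) :
    IntegrableOn (fun X => eulerWeight a X * X ^ k) (Set.Ioo 0 1) := by
  have h := (Complex.betaIntegral_convergent (u := (k : ℂ) + 1 - a) (v := a)
    (by simp; linarith [k.cast_nonneg (α := ℝ)]) (by simpa using ha))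
  rw [intervalIntegrable_iff_integrableOn_Ioo_of_le zero_le_one] at h
  refine IntegrableOn.congr_fun h.re (fun X hX => ?_) measurableSet_Ioo
  rw [← ofReal_eulerWeight_mul_pow hX k]
  exact Complex.ofReal_re _

lemma integrableOn_eulerWeight : IntegrableOn (eulerWeight a) (Set.Ioo 0 1) := by
  simpa using integrableOn_eulerWeight_mul_pow ha ha1 0

lemma integral_eulerWeight_mul_pow (k : ℕ) :
    ∫ X in Set.Ioo (0 : ℝ) 1, eulerWeight a X * X ^ k =
      Real.pi / Real.sin (Real.pi * a) *
        ((∏ j ∈ Finset.range k, ((j : ℝ) + 1 - a)) / (k.factorial : ℝ)) := by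
  have hre : 0 < ((k : ℂ) + 1 - a).re := by simp; linarith [k.cast_nonneg (α := ℝ)]
  have hB := Complex.Gamma_mul_Gamma_eq_betaIntegral hre (show 0 < (a : ℂ).re by simpa using ha)
  rw [show (k : ℂ) + 1 - a + a = k + 1 by ring, Complex.Gamma_nat_eq_factorial] at hB
  have hG : ∀ m : ℕ, Complex.Gamma ((m : ℂ) + 1 - a) =
      ((∏ j ∈ Finset.range m, ((j : ℝ) + 1 - a) : ℝ) : ℂ) * Complex.Gamma (1 - a) := by
    intro m
    induction m with
    | zero => simp
    | succ m ih =>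
      have hm : ((m : ℂ) + 1 - a) ≠ 0 := by
        have : (m : ℝ) + 1 - a ≠ 0 := by linarith [m.cast_nonneg (α := ℝ)]
        exact_mod_cast this
      rw [Finset.prod_range_succ, show (((m + 1 : ℕ) : ℂ) + 1 - a) = ((m : ℂ) + 1 - a) + 1 by
        push_cast; ring, Complex.Gamma_add_one _ hm, ih]
      push_cast; ring
  have hI : ((∫ X in Set.Ioo (0 : ℝ) 1, eulerWeight a X * X ^ k : ℝ) : ℂ) =
      Complex.betaIntegral ((k : ℂ) + 1 - a) a := by
    rw [Complex.betaIntegral, intervalIntegral.integral_of_le zero_le_one,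
      integral_Ioc_eq_integral_Ioo, ← integral_complex_ofReal]
    exact setIntegral_congr_fun measurableSet_Ioo
      fun X hX => ofReal_eulerWeight_mul_pow hX k
  have hR := Complex.Gamma_mul_Gamma_one_sub (a : ℂ)
  rw [hG, mul_assoc, mul_comm (Complex.Gamma (1 - a)), hR, ← hI] at hB
  have hk : (k.factorial : ℝ) ≠ 0 := by exact_mod_cast k.factorial_ne_zero
  rw [mul_div_assoc', eq_div_iff hk]
  have hB' : (∏ j ∈ Finset.range k, ((j : ℝ) + 1 - a)) * (Real.pi / Real.sin (Real.pi * a)) =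
      k.factorial * ∫ X in Set.Ioo (0 : ℝ) 1, eulerWeight a X * X ^ k := by
    exact_mod_cast hB
  linarith

omit ha ha1 in
/-- The binomial series of `(1 - z)⁻ᵃ`. -/
lemma hasSum_one_sub_cpow_neg (a : ℝ) {z : ℂ} (hz : ‖z‖ < 1) :
    HasSum (fun k : ℕ => ((∏ j ∈ Finset.range k, ((j + a) / ((j : ℝ) + 1)) : ℝ) : ℂ) * z ^ k)
      ((1 - z) ^ (-a : ℂ)) := by
  have h := (Complex.one_div_one_sub_cpow_hasFPowerSeriesOnBall_zero (a : ℂ)).hasSum (y := z)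
    (by simpa [enorm_eq_nnnorm] using! hz)
  simp only [zero_add, FormalMultilinearSeries.ofScalars_apply_eq, smul_eq_mul] at h
  rw [Complex.cpow_neg, ← one_div]
  refine h.congr_fun fun k => ?_
  congr 1
  rw [Ring.choose, show (a : ℂ) + k - 1 - k + 1 = a by ring]
  have hk : (k.factorial : ℂ) ≠ 0 := by exact_mod_cast k.factorial_ne_zero
  apply mul_left_cancel₀ hk
  have h2 := Ring.factorial_nsmul_multichoose_eq_ascPochhammer (a : ℂ) k
  rw [nsmul_eq_mul] at h2
  rw [h2, Polynomial.ascPochhammer_smeval_eq_eval]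
  clear h h2 hk
  induction k with
  | zero => simp
  | succ k ih =>
    rw [ascPochhammer_succ_eval, ← ih, Finset.prod_range_succ, Nat.factorial_succ]
    have : (k : ℂ) + 1 ≠ 0 := by exact_mod_cast k.succ_ne_zero
    push_cast
    field_simp
    ring

/-- Euler's integral representation of the hypergeometric series. -/
lemma eulerIntegral_eq_powerSum {t : ℂ} (ht : ‖t‖ < 1) :
    eulerIntegral a t = ((Real.pi / Real.sin (Real.pi * a) : ℝ) : ℂ) *
      powerSum (fun k => (coeffA a k : ℂ)) t := by
  set b : ℕ → ℝ := fun k => ∏ j ∈ Finset.range k, ((j + a) / ((j : ℝ) + 1)) with hb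
  have hb0 : ∀ k, 0 ≤ b k := fun k => Finset.prod_nonneg fun j _ => by positivity
  have hb1 : ∀ k, b k ≤ 1 := fun k => Finset.prod_le_one (fun j _ => by positivity) fun j _ => by
    rw [div_le_one (by positivity)]; linarith
  set G : ℕ → ℝ → ℂ := fun k X => ((b k : ℂ) * t ^ k) * ((eulerWeight a X * X ^ k : ℝ) : ℂ) with hG
  have hint : ∀ k, Integrable (G k) (volume.restrict (Set.Ioo 0 1)) := fun k =>
    (Integrable.ofReal (integrableOn_eulerWeight_mul_pow ha ha1 k)).const_mul _
  have hnorm : ∀ k, ∫ X in Set.Ioo (0 : ℝ) 1, ‖G k X‖ ≤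
      (∫ X in Set.Ioo (0 : ℝ) 1, eulerWeight a X) * ‖t‖ ^ k := by
    intro k
    rw [← integral_mul_const]
    refine setIntegral_mono_on (hint k).norm ((integrableOn_eulerWeight ha ha1).mul_const _)
      measurableSet_Ioo fun X hX => ?_
    have hw := eulerWeight_nonneg a hX
    have hXk : 0 ≤ X ^ k := pow_nonneg hX.1.le k
    have hXk1 : X ^ k ≤ 1 := pow_le_one₀ hX.1.le hX.2.le
    rw [hG]
    simp only [norm_mul, norm_pow, Complex.norm_real, Real.norm_of_nonneg (hb0 k),
      Real.norm_of_nonneg hw, Real.norm_of_nonneg hX.1.le]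
    calc b k * ‖t‖ ^ k * (eulerWeight a X * X ^ k) ≤ 1 * ‖t‖ ^ k * (eulerWeight a X * 1) := by
          gcongr
          exact hb1 k
      _ = _ := by ring
  have hsum : Summable fun k => ∫ X in Set.Ioo (0 : ℝ) 1, ‖G k X‖ :=
    Summable.of_nonneg_of_le (fun k => integral_nonneg fun X => norm_nonneg _) hnorm
      ((summable_geometric_of_lt_one (norm_nonneg t) ht).mul_left _)
  have h := hasSum_integral_of_summable_integral_norm hint hsum
  have e1 : ∫ X in Set.Ioo (0 : ℝ) 1, ∑' k, G k X = eulerIntegral a t := by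
    refine setIntegral_congr_fun measurableSet_Ioo fun X hX => ?_
    have htX : ‖t * (X : ℂ)‖ < 1 := by
      rw [norm_mul, Complex.norm_real, Real.norm_of_nonneg hX.1.le]
      exact (mul_le_of_le_one_right (norm_nonneg t) hX.2.le).trans_lt ht
    rw [← ((hasSum_one_sub_cpow_neg a htX).mul_left (eulerWeight a X : ℂ)).tsum_eq]
    refine tsum_congr fun k => ?_
    simp only [hG, hb]
    push_cast
    ring
  rw [e1] at h
  refine h.unique ?_
  refine ((((tempered_coeffA ha ha1).ofReal).hasSum ht).mul_left _).congr_fun fun k => ?_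
  rw [hG, integral_const_mul, integral_complex_ofReal, integral_eulerWeight_mul_pow ha ha1]
  have hA : coeffA a k =
      b k * ((∏ j ∈ Finset.range k, ((j : ℝ) + 1 - a)) / (k.factorial : ℝ)) := by
    rw [hb, ← Finset.prod_range_add_one_eq_factorial]
    push_cast
    rw [← Finset.prod_div_distrib, ← Finset.prod_mul_distrib, coeffA]
    refine Finset.prod_congr rfl fun j _ => ?_
    have : (j : ℝ) + 1 ≠ 0 := by positivity
    field_simp
  rw [hA]
  push_cast
  ring

lemma legendreP_eq_powerSum {t : ℂ} (ht : ‖t‖ < 1) :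
    legendreP (-a) (1 - 2 * t) = powerSum (fun k => (coeffA a k : ℂ)) t := by
  rw [legendreP_eq_eulerIntegral ha, eulerIntegral_eq_powerSum ha ha1 ht, ← mul_assoc,
    ← Complex.ofReal_mul]
  have hs : 0 < Real.sin (Real.pi * a) :=
    Real.sin_pos_of_pos_of_lt_pi (by positivity) (by nlinarith [Real.pi_pos])
  have := Real.pi_pos
  rw [div_mul_div_comm, mul_comm Real.pi (Real.sin _), div_self (by positivity),
    Complex.ofReal_one, one_mul]

omit ha ha1 in
lemma one_sub_mul_mem_slitPlane {t : ℂ} (ht : 1 - t ∈ Complex.slitPlane) {X : ℝ}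
    (hX : X ∈ Set.Icc (0 : ℝ) 1) : 1 - t * (X : ℂ) ∈ Complex.slitPlane := by
  have h := Complex.starConvex_one_slitPlane ht (by linarith [hX.2] : 0 ≤ 1 - X) hX.1 (by ring)
  convert h using 1
  simp only [Complex.real_smul]
  push_cast
  ring

lemma differentiableAt_eulerIntegral {t : ℂ} (ht : 1 - t ∈ Complex.slitPlane) :
    DifferentiableAt ℂ (eulerIntegral a) t := by
  have hopen : IsOpen {s : ℂ | 1 - s ∈ Complex.slitPlane} :=
    Complex.isOpen_slitPlane.preimage (by fun_prop)
  obtain ⟨δ, hδ, hball⟩ := Metric.nhds_basis_closedBall.mem_iff.1 (hopen.mem_nhds ht)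
  have hK : IsCompact (Metric.closedBall t δ ×ˢ Set.Icc (0 : ℝ) 1) :=
    (isCompact_closedBall t δ).prod isCompact_Icc
  -- powers of `1 - s X` are bounded uniformly for `s` near `t`, by compactness
  have hbound : ∀ c : ℂ, ∃ B : ℝ, ∀ s ∈ Metric.closedBall t δ, ∀ X ∈ Set.Icc (0 : ℝ) 1,
      ‖(1 - s * (X : ℂ)) ^ c‖ ≤ B := by
    intro c
    have hcont : ContinuousOn (fun p : ℂ × ℝ => (1 - p.1 * (p.2 : ℂ)) ^ c)
        (Metric.closedBall t δ ×ˢ Set.Icc (0 : ℝ) 1) := by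
      intro p hp
      refine ContinuousWithinAt.cpow (by fun_prop) continuousWithinAt_const ?_
      exact one_sub_mul_mem_slitPlane (hball hp.1) hp.2
    obtain ⟨B, hB⟩ := hK.exists_bound_of_continuousOn hcont
    exact ⟨B, fun s hs X hX => hB (s, X) ⟨hs, hX⟩⟩
  obtain ⟨B, hB⟩ := hbound (-a)
  obtain ⟨B', hB'⟩ := hbound (-a - 1)
  have hw := integrableOn_eulerWeight ha ha1
  have hm : ∀ (s c : ℂ), AEStronglyMeasurable
      (fun X : ℝ => (eulerWeight a X : ℂ) * (1 - s * (X : ℂ)) ^ c)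
      (volume.restrict (Set.Ioo (0 : ℝ) 1)) := fun s c =>
    (((Complex.measurable_ofReal.comp (measurable_eulerWeight a)).mul
      (measurable_one_sub_mul_cpow s c))).aestronglyMeasurable
  have key := hasDerivAt_integral_of_dominated_loc_of_deriv_le
    (μ := volume.restrict (Set.Ioo (0 : ℝ) 1)) (x₀ := t) (s := Metric.ball t δ)
    (F := fun s X => (eulerWeight a X : ℂ) * (1 - s * (X : ℂ)) ^ (-a : ℂ))
    (F' := fun s X => (a * X : ℂ) * ((eulerWeight a X : ℂ) * (1 - s * (X : ℂ)) ^ (-a - 1 : ℂ)))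
    (bound := fun X => a * (eulerWeight a X * B'))
    (Metric.ball_mem_nhds t hδ) (Eventually.of_forall fun s => hm s _) ?_ ?_ ?_
    ((hw.mul_const B').const_mul a) ?_
  · exact key.2.differentiableAt
  · refine Integrable.mono' (hw.mul_const B) (hm t _) ?_
    refine (ae_restrict_mem measurableSet_Ioo).mono fun X hX => ?_
    rw [norm_mul, Complex.norm_real, Real.norm_of_nonneg (eulerWeight_nonneg a hX)]
    exact mul_le_mul_of_nonneg_left
      (hB t (Metric.mem_closedBall_self hδ.le) X (Set.Ioo_subset_Icc_self hX))
      (eulerWeight_nonneg a hX)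
  · exact (Measurable.aestronglyMeasurable (by fun_prop)).mul (hm t _)
  · refine (ae_restrict_mem measurableSet_Ioo).mono fun X hX s hs => ?_
    have h1 := hB' s (Metric.ball_subset_closedBall hs) X (Set.Ioo_subset_Icc_self hX)
    have hw0 := eulerWeight_nonneg a hX
    rw [norm_mul, norm_mul, norm_mul, Complex.norm_real, Complex.norm_real, Complex.norm_real,
      Real.norm_of_nonneg hw0, Real.norm_of_nonneg ha.le, Real.norm_of_nonneg hX.1.le]
    have h2 := mul_le_mul_of_nonneg_left h1 hw0
    have h3 : 0 ≤ eulerWeight a X * ‖(1 - s * (X : ℂ)) ^ (-a - 1 : ℂ)‖ :=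
      mul_nonneg hw0 (norm_nonneg _)
    calc _ ≤ a * 1 * (eulerWeight a X * ‖(1 - s * (X : ℂ)) ^ (-a - 1 : ℂ)‖) := by
          gcongr
          exact hX.2.le
      _ ≤ _ := by
          rw [mul_one]
          gcongr
  · refine (ae_restrict_mem measurableSet_Ioo).mono fun X hX s hs => ?_
    have hslit := one_sub_mul_mem_slitPlane (hball (Metric.ball_subset_closedBall hs))
      (Set.Ioo_subset_Icc_self hX)
    have h1 : HasDerivAt (fun s : ℂ => 1 - s * (X : ℂ)) (-(X : ℂ)) s := by
      simpa using ((hasDerivAt_id s).mul_const (X : ℂ)).const_sub 1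
    refine ((h1.cpow_const (c := (-a : ℂ)) hslit).const_mul (eulerWeight a X : ℂ)).congr_deriv ?_
    ring

end

/-! ### Boundary values of Euler's integral at the point `2` of its cut -/

/-- The logarithm has boundary values on the negative axis from both sides; `σ` selects the side. -/
lemma exists_tendsto_log {σ : ℝ} (hσ : σ ≠ 0) {x : ℝ} (hx : x < 0) :
    ∃ v : ℂ, Tendsto Complex.log (𝓝[{z : ℂ | 0 < σ * z.im}] (x : ℂ)) (𝓝 v) := by
  rcases hσ.lt_or_gt with h | h
  · refine ⟨_, (Complex.tendsto_log_nhdsWithin_im_neg_of_re_neg_of_im_zero (z := (x : ℂ))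
      (by simpa using hx) (by simp)).mono_left (nhdsWithin_mono _ fun z hz => ?_)⟩
    exact neg_of_mul_pos_right hz h.le
  · refine ⟨_, (Complex.tendsto_log_nhdsWithin_im_nonneg_of_re_neg_of_im_zero (z := (x : ℂ))
      (by simpa using hx) (by simp)).mono_left (nhdsWithin_mono _ fun z hz => ?_)⟩
    exact (pos_of_mul_pos_right hz h.le).le

/-- The factor `(1 - s X)⁻ᵃ` of Euler's integrand has a limit as `s → 2` from one side. -/
lemma exists_tendsto_one_sub_mul_cpow (a : ℝ) {σ : ℝ} (hσ : σ ≠ 0) :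
    ∃ g : ℝ → ℂ, ∀ X ∈ Set.Ioo (0 : ℝ) 1, X ≠ 1 / 2 →
      Tendsto (fun s : ℂ => (1 - s * (X : ℂ)) ^ (-a : ℂ)) (𝓝[{z : ℂ | 0 < σ * z.im}] 2)
        (𝓝 (g X)) := by
  suffices h : ∀ X : ℝ, ∃ v : ℂ, X ∈ Set.Ioo (0 : ℝ) 1 → X ≠ 1 / 2 →
      Tendsto (fun s : ℂ => (1 - s * (X : ℂ)) ^ (-a : ℂ)) (𝓝[{z : ℂ | 0 < σ * z.im}] 2)
        (𝓝 v) by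
    choose g hg using h
    exact ⟨g, hg⟩
  intro X
  by_cases hX : X ∈ Set.Ioo (0 : ℝ) 1 ∧ X ≠ 1 / 2
  swap
  · exact ⟨0, fun h1 h2 => absurd ⟨h1, h2⟩ hX⟩
  obtain ⟨hX, hX2⟩ := hX
  have hc : ContinuousAt (fun s : ℂ => 1 - s * (X : ℂ)) 2 := by fun_prop
  have e : (1 : ℂ) - 2 * X = ((1 - 2 * X : ℝ) : ℂ) := by push_cast; ring
  rcases hX2.lt_or_gt with h | h
  · refine ⟨_, fun _ _ => ((hc.cpow continuousAt_const ?_).tendsto).mono_left nhdsWithin_le_nhds⟩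
    rw [e, Complex.ofReal_mem_slitPlane]
    linarith
  · have hneg : 1 - 2 * X < 0 := by linarith
    obtain ⟨v, hv⟩ := exists_tendsto_log (neg_ne_zero.2 hσ) hneg
    rw [← e] at hv
    have hu : Tendsto (fun s : ℂ => 1 - s * (X : ℂ)) (𝓝[{z : ℂ | 0 < σ * z.im}] 2)
        (𝓝[{z : ℂ | 0 < -σ * z.im}] (1 - 2 * X)) := by
      refine tendsto_nhdsWithin_iff.2 ⟨hc.tendsto.mono_left nhdsWithin_le_nhds, ?_⟩
      filter_upwards [self_mem_nhdsWithin] with s hs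
      have hs' : 0 < σ * s.im := hs
      simp only [Complex.sub_im, Complex.one_im, Complex.mul_im, Complex.ofReal_im,
        Complex.ofReal_re, mul_zero, zero_add, zero_sub]
      have := mul_pos hs' hX.1
      linarith
    refine ⟨Complex.exp (v * (-a)), fun _ _ => ?_⟩
    have hlim := (Complex.continuous_exp.tendsto _).comp ((hv.comp hu).mul_const (-a : ℂ))
    refine hlim.congr' ?_
    have hne : ∀ᶠ s in 𝓝[{z : ℂ | 0 < σ * z.im}] (2 : ℂ), 1 - s * (X : ℂ) ≠ 0 :=
      (hc.eventually_ne (by rw [e]; exact_mod_cast hneg.ne)).filter_mono nhdsWithin_le_nhds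
    filter_upwards [hne] with s hs
    simp only [Function.comp]
    rw [Complex.cpow_def_of_ne_zero hs]

lemma integrableOn_abs_one_sub_two_mul_rpow {a : ℝ} (ha1 : a < 1) :
    IntegrableOn (fun X : ℝ => |1 - 2 * X| ^ (-a)) (Set.Ioo 0 1) := by
  have h := (intervalIntegral.intervalIntegrable_cpow' (a := -1) (b := 1) (r := (-a : ℂ))
    (by simpa using ha1)).norm
  have h2 := (h.comp_sub_left 1).comp_mul_left (c := 2)
  norm_num at h2
  have h3 := h2.symm
  rw [intervalIntegrable_iff_integrableOn_Ioo_of_le zero_le_one] at h3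
  refine h3.congr_fun (fun X _ => ?_) measurableSet_Ioo
  have e := Complex.norm_cpow_real (1 - 2 * (X : ℂ)) (-a)
  have e2 : (1 : ℂ) - 2 * X = ((1 - 2 * X : ℝ) : ℂ) := by push_cast; ring
  rw [Complex.ofReal_neg] at e
  rw [e2, Complex.norm_real, Real.norm_eq_abs] at e
  rw [← e, ← e2]

/-- Dominated convergence for Euler's integral as `s → 2` from one side, along a path that does not
approach the point `2` tangentially to the cut: the bound on `|1 - s X|` keeps the moving
singularity under control. The limit depends on the side only. -/
lemma exists_tendsto_eulerIntegral {a : ℝ} (ha : 0 < a) (ha1 : a < 1) {σ : ℝ} (hσ : σ ≠ 0) :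
    ∃ L : ℂ, ∀ u : ℝ → ℂ, Tendsto u (𝓝[>] 0) (𝓝[{z : ℂ | 0 < σ * z.im}] 2) →
      (∀ᶠ ε in 𝓝[>] (0 : ℝ), ∀ X ∈ Set.Ioo (0 : ℝ) 1,
        |1 - 2 * X| ≤ 2 * ‖1 - u ε * (X : ℂ)‖) →
      Tendsto (fun ε => eulerIntegral a (u ε)) (𝓝[>] 0) (𝓝 L) := by
  obtain ⟨g, hg⟩ := exists_tendsto_one_sub_mul_cpow a hσ
  refine ⟨∫ X in Set.Ioo (0 : ℝ) 1, (eulerWeight a X : ℂ) * g X, fun u hu hb => ?_⟩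
  have hw := integrableOn_eulerWeight ha ha1
  have hne : ∀ᵐ X : ℝ ∂(volume.restrict (Set.Ioo (0 : ℝ) 1)), X ≠ 1 / 2 :=
    ae_restrict_of_ae (Measure.ae_ne volume _)
  refine tendsto_integral_filter_of_dominated_convergence
    (fun X => 2 * (2 * eulerWeight a X + 4 * |1 - 2 * X| ^ (-a))) ?_ ?_ ?_ ?_
  · exact Eventually.of_forall fun ε => ((Complex.measurable_ofReal.comp
      (measurable_eulerWeight a)).mul (measurable_one_sub_mul_cpow _ _)).aestronglyMeasurable
  · filter_upwards [hb] with ε hε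
    filter_upwards [ae_restrict_mem measurableSet_Ioo, hne] with X hX hX2
    have hw0 := eulerWeight_nonneg a hX
    have habs : 0 < |1 - 2 * X| := abs_pos.2 fun h => hX2 (by linarith)
    have h1 := hε X hX
    have hn : 0 < ‖1 - u ε * (X : ℂ)‖ := by linarith
    have h2a : (2 : ℝ) ^ a ≤ 2 := by
      simpa using Real.rpow_le_rpow_of_exponent_le one_le_two ha1.le
    have e : ‖(1 - u ε * (X : ℂ)) ^ (-a : ℂ)‖ = ‖1 - u ε * (X : ℂ)‖ ^ (-a) := by
      have := Complex.norm_cpow_real (1 - u ε * (X : ℂ)) (-a)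
      simpa using this
    have h3 : ‖1 - u ε * (X : ℂ)‖ ^ (-a) ≤ 2 * |1 - 2 * X| ^ (-a) := by
      have hy : |1 - 2 * X| / 2 ≤ ‖1 - u ε * (X : ℂ)‖ := by linarith
      have := Real.rpow_le_rpow_of_nonpos (z := -a) (by positivity : 0 < |1 - 2 * X| / 2) hy
        (by linarith)
      refine this.trans ?_
      rw [Real.div_rpow habs.le zero_le_two, Real.rpow_neg zero_le_two, div_inv_eq_mul, mul_comm]
      exact mul_le_mul_of_nonneg_right h2a (Real.rpow_nonneg habs.le _)
    rw [norm_mul, Complex.norm_real, Real.norm_of_nonneg hw0, e]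
    have hp := Real.rpow_nonneg habs.le (-a)
    -- away from `1 / 2` the second factor is bounded, near `1 / 2` the weight is bounded
    have h4 : eulerWeight a X * |1 - 2 * X| ^ (-a) ≤
        2 * eulerWeight a X + 4 * |1 - 2 * X| ^ (-a) := by
      rcases le_or_gt (1 / 2) |1 - 2 * X| with h | h
      · have : |1 - 2 * X| ^ (-a) ≤ 2 := by
          have := Real.rpow_le_rpow_of_nonpos (z := -a) (by norm_num : (0 : ℝ) < 1 / 2) h
            (by linarith)
          rw [one_div, Real.inv_rpow zero_le_two, Real.rpow_neg zero_le_two, inv_inv] at this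
          linarith
        have := mul_le_mul_of_nonneg_left this hw0
        linarith
      · rw [abs_lt] at h
        have hq : (0 : ℝ) < 1 / 4 := by norm_num
        have b1 := Real.rpow_le_rpow_of_nonpos (z := -a) hq (by linarith : 1 / 4 ≤ X)
          (by linarith)
        have b2 := Real.rpow_le_rpow_of_nonpos (z := a - 1) hq (by linarith : 1 / 4 ≤ 1 - X)
          (by linarith)
        have b3 : eulerWeight a X ≤ 4 := by
          refine (mul_le_mul b1 b2 (Real.rpow_nonneg (by linarith) _)
            (Real.rpow_nonneg hq.le _)).trans ?_
          rw [← Real.rpow_add hq, show -a + (a - 1) = -1 by ring, Real.rpow_neg_one]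
          norm_num
        have := mul_le_mul_of_nonneg_right b3 hp
        linarith
    calc eulerWeight a X * ‖1 - u ε * (X : ℂ)‖ ^ (-a)
        ≤ eulerWeight a X * (2 * |1 - 2 * X| ^ (-a)) := mul_le_mul_of_nonneg_left h3 hw0
      _ ≤ _ := by linarith
  · exact ((hw.const_mul 2).add ((integrableOn_abs_one_sub_two_mul_rpow ha1).const_mul 4)).const_mul
      2
  · filter_upwards [ae_restrict_mem measurableSet_Ioo, hne] with X hX hX2
    exact ((hg X hX hX2).comp hu).const_mul _

/-! ### Convergence on the closed unit disc and Abel's theorem -/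

lemma partialSum_succ (f : ℕ → ℂ) (n : ℕ) :
    partialSum f (n + 1) = partialSum f n + f (n + 1) :=
  Finset.sum_Icc_succ_top (by omega) f

lemma partialSum_eq_sum_range (f : ℕ → ℂ) (n : ℕ) :
    partialSum f n = ∑ k ∈ Finset.range n, f (k + 1) := by
  induction n with
  | zero => simp [partialSum]
  | succ n ih => rw [partialSum_succ, ih, Finset.sum_range_succ]

lemma tendsto_partialSum {f : ℕ → ℂ} (hf : SeriesConverges f) :
    Tendsto (partialSum f) atTop (𝓝 (seriesSum f)) := tendsto_nhds_limUnder hf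

lemma seriesSum_eq {f : ℕ → ℂ} {s : ℂ} (h : Tendsto (partialSum f) atTop (𝓝 s)) :
    seriesSum f = s := h.limUnder_eq

lemma tendsto_partialSum_powerSum {c : ℕ → ℂ} (hc : Tempered c) (h0 : c 0 = 0) {t : ℂ}
    (ht : ‖t‖ < 1) :
    Tendsto (partialSum fun k => c k * t ^ k) atTop (𝓝 (powerSum c t)) := by
  have h := ((hasSum_nat_add_iff' 1).2 (hc.hasSum ht)).tendsto_sum_nat
  simp only [Finset.range_one, Finset.sum_singleton, h0, zero_mul, sub_zero] at h
  exact h.congr fun n => (partialSum_eq_sum_range _ n).symm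

/-- Dirichlet's test. -/
lemma seriesConverges_of_antitone {c : ℕ → ℝ} (hc : ∀ k, 1 ≤ k → c (k + 1) ≤ c k)
    (h0 : Tendsto c atTop (𝓝 0)) {t : ℂ} (ht : ‖t‖ ≤ 1) (ht1 : t ≠ 1) :
    SeriesConverges fun k => (c k : ℂ) * t ^ k := by
  have hanti : Antitone fun k => c (k + 1) := antitone_nat_of_succ_le fun k => hc _ (by omega)
  have hb : ∀ n, ‖∑ i ∈ Finset.range n, t ^ (i + 1)‖ ≤ 2 / ‖t - 1‖ := by
    intro n
    simp only [pow_succ]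
    rw [← Finset.sum_mul, geom_sum_eq ht1, norm_mul, norm_div]
    have hn : ‖t ^ n - 1‖ ≤ 2 := by
      refine (norm_sub_le _ _).trans ?_
      rw [norm_pow, norm_one]
      linarith [pow_le_one₀ (n := n) (norm_nonneg t) ht]
    have hpos : 0 < ‖t - 1‖ := norm_pos_iff.2 (sub_ne_zero.2 ht1)
    calc ‖t ^ n - 1‖ / ‖t - 1‖ * ‖t‖ ≤ 2 / ‖t - 1‖ * 1 := by gcongr
      _ = _ := mul_one _
  obtain ⟨s, hs⟩ := cauchySeq_tendsto_of_complete
    (hanti.cauchySeq_series_mul_of_tendsto_zero_of_bounded ((tendsto_add_atTop_iff_nat 1).2 h0) hb)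
  refine ⟨s, hs.congr fun n => ?_⟩
  rw [partialSum_eq_sum_range]
  simp

/-- Abel's theorem at a boundary point `t`, in a cone. -/
lemma tendsto_powerSum_mul_nhdsWithin_stolzCone {c : ℕ → ℂ} (h0 : c 0 = 0) {t : ℂ}
    (h : SeriesConverges fun k => c k * t ^ k) {s : ℝ} (hs : 0 < s) :
    Tendsto (fun z => powerSum c (t * z)) (𝓝[Complex.stolzCone s] 1)
      (𝓝 (seriesSum fun k => c k * t ^ k)) := by
  have h1 : Tendsto (fun n => ∑ k ∈ Finset.range n, c k * t ^ k) atTop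
      (𝓝 (seriesSum fun k => c k * t ^ k)) := by
    rw [← tendsto_add_atTop_iff_nat 1]
    refine (tendsto_partialSum h).congr fun n => ?_
    rw [partialSum_eq_sum_range, Finset.sum_range_succ']
    simp [h0]
  refine (Complex.tendsto_tsum_powerSeries_nhdsWithin_stolzCone h1 hs).congr fun z => ?_
  simp only [powerSum, mul_pow, mul_assoc]

/-- Abel's theorem along the radius. -/
lemma tendsto_powerSum_mul_ofReal {c : ℕ → ℂ} (h0 : c 0 = 0) {t : ℂ}
    (h : SeriesConverges fun k => c k * t ^ k) :
    Tendsto (fun r : ℝ => powerSum c (t * (r : ℂ))) (𝓝[<] 1)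
      (𝓝 (seriesSum fun k => c k * t ^ k)) := by
  refine (tendsto_powerSum_mul_nhdsWithin_stolzCone h0 h one_pos).comp
    (tendsto_nhdsWithin_iff.2 ⟨?_, ?_⟩)
  · have : ContinuousAt (fun r : ℝ => (r : ℂ)) 1 := by fun_prop
    simpa using this.tendsto.mono_left (nhdsWithin_le_nhds (s := Set.Iio (1 : ℝ)))
  · filter_upwards [self_mem_nhdsWithin] with r hr
    have hr' : r < 1 := hr
    simpa [Complex.stolzCone] using hr'

/-! ### Analytic continuation from the interval `(0, 1)` -/

/-- Functions that agree on `(0, 1)` satisfy the hypothesis of the identity theorem at `1 / 2`. -/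
lemma frequently_eq_of_eqOn_Ioo {f g : ℂ → ℂ}
    (h : ∀ x : ℝ, 0 < x → x < 1 → f (x : ℂ) = g (x : ℂ)) :
    ∃ᶠ z in 𝓝[≠] ((1 / 2 : ℝ) : ℂ), f z = g z := by
  have ht : Tendsto (fun x : ℝ => (x : ℂ)) (𝓝[≠] (1 / 2)) (𝓝[≠] ((1 / 2 : ℝ) : ℂ)) := by
    refine tendsto_nhdsWithin_iff.2
      ⟨(Complex.continuous_ofReal.tendsto _).mono_left nhdsWithin_le_nhds, ?_⟩
    filter_upwards [self_mem_nhdsWithin] with x hx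
    simpa only [Set.mem_compl_iff, Set.mem_singleton_iff, Complex.ofReal_inj] using hx
  refine ht.frequently (Eventually.frequently ?_)
  have : Set.Ioo (0 : ℝ) 1 ∈ 𝓝 (1 / 2 : ℝ) := Ioo_mem_nhds (by norm_num) (by norm_num)
  filter_upwards [mem_nhdsWithin_of_mem_nhds this] with x hx
  exact h x hx.1 hx.2

lemma one_sub_mem_slitPlane {t : ℂ} (ht : ‖t‖ ≤ 1) (ht1 : t ≠ 1) :
    1 - t ∈ Complex.slitPlane := by
  rw [Complex.mem_slitPlane_iff]
  by_contra! h
  have him : t.im = 0 := by simpa using h.2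
  have hre : 1 ≤ t.re := by simpa using h.1
  have := (Complex.re_le_norm t).trans ht
  exact ht1 (Complex.ext (by simp; linarith) (by simpa using him))

/-- The argument of the logarithm in the closed form avoids the cut. -/
lemma mul_one_sub_div_mem_slitPlane {c : ℝ} (hc : 0 < c) {t : ℂ} (ht : t ∈ Complex.slitPlane)
    (ht1 : 1 - t ∈ Complex.slitPlane) : (c : ℂ) * (1 - t) / t ∈ Complex.slitPlane := by
  have ht0 := Complex.slitPlane_ne_zero ht
  by_cases him : t.im = 0
  · have e : t = (t.re : ℂ) := Complex.ext (by simp) (by simpa using him)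
    rw [e, Complex.ofReal_mem_slitPlane] at ht
    rw [e, ← Complex.ofReal_one, ← Complex.ofReal_sub, Complex.ofReal_mem_slitPlane] at ht1
    rw [e, ← Complex.ofReal_one, ← Complex.ofReal_sub, ← Complex.ofReal_mul, ← Complex.ofReal_div,
      Complex.ofReal_mem_slitPlane]
    positivity
  · rw [Complex.mem_slitPlane_iff]
    right
    have e : (c : ℂ) * (1 - t) / t = (c : ℂ) * (t⁻¹ - 1) := by field_simp
    rw [e, Complex.im_ofReal_mul]
    have hn : 0 < Complex.normSq t := Complex.normSq_pos.2 ht0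
    simp only [Complex.sub_im, Complex.inv_im, Complex.one_im, sub_zero]
    exact mul_ne_zero hc.ne' (div_ne_zero (neg_ne_zero.2 him) hn.ne')

section

variable {a : ℝ} (ha : 0 < a) (ha1 : a < 1)
include ha ha1

lemma sin_pi_mul_pos : 0 < Real.sin (Real.pi * a) :=
  Real.sin_pos_of_pos_of_lt_pi (by positivity) (by nlinarith [Real.pi_pos])

lemma differentiableAt_legendreP_one_sub {t : ℂ} (ht : 1 - t ∈ Complex.slitPlane) :
    DifferentiableAt ℂ (fun t => legendreP (-a) (1 - 2 * t)) t := by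
  simp only [legendreP_eq_eulerIntegral ha]
  exact (differentiableAt_eulerIntegral ha ha1 ht).const_mul _

omit ha1 in
lemma legendreP_two_mul_sub_one (t : ℂ) :
    legendreP (-a) (2 * t - 1) =
      ((Real.sin (Real.pi * a) / Real.pi : ℝ) : ℂ) * eulerIntegral a (1 - t) := by
  rw [← legendreP_eq_eulerIntegral ha]
  congr 1; ring

lemma differentiableAt_closedForm {c : ℝ} (hc : 0 < c) (r : ℝ) {t : ℂ}
    (ht : t ∈ Complex.slitPlane) (ht1 : 1 - t ∈ Complex.slitPlane) :
    DifferentiableAt ℂ (closedForm (-a) r c) t := by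
  have h1 := differentiableAt_legendreP_one_sub ha ha1 ht1
  have h2 : DifferentiableAt ℂ (fun t => legendreP (-a) (2 * t - 1)) t := by
    simp only [legendreP_two_mul_sub_one ha]
    refine DifferentiableAt.const_mul ?_ _
    exact DifferentiableAt.comp (g := eulerIntegral a) (f := fun t : ℂ => 1 - t) t
      (differentiableAt_eulerIntegral ha ha1 (by simpa using ht)) (by fun_prop)
  have ht0 := Complex.slitPlane_ne_zero ht
  have h3 : DifferentiableAt ℂ (fun t : ℂ => Complex.log ((c : ℂ) * (1 - t) / t)) t :=
    DifferentiableAt.clog (by fun_prop (disch := exact ht0))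
      (mul_one_sub_div_mem_slitPlane hc ht ht1)
  exact (((h2.const_mul _).div_const _).neg).add ((h1.div_const 2).mul h3)

/-- The identity for the weights `weightS` on the open disc. -/
lemma powerSum_weightS_eq {t : ℂ} (ht : ‖t‖ < 1) :
    powerSum (fun k => ((coeffA a k * weightS a k : ℝ) : ℂ)) t =
      -legendreP (-a) (1 - 2 * t) * Complex.log (1 - t) := by
  rw [legendreP_eq_powerSum ha ha1 ht]
  have hA := ((tempered_coeffA ha ha1).ofReal).analyticOnNhd
  have hlog : AnalyticOnNhd ℂ (fun t : ℂ => Complex.log (1 - t)) (Metric.ball 0 1) := by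
    intro z hz
    refine AnalyticAt.clog (by fun_prop) (one_sub_mem_slitPlane (mem_ball_zero_iff.1 hz).le ?_)
    rintro rfl
    simp at hz
  refine AnalyticOnNhd.eqOn_of_preconnected_of_frequently_eq
    (z₀ := ((1 / 2 : ℝ) : ℂ)) (((tempered_S ha ha1).ofReal).analyticOnNhd) (hA.neg.mul hlog)
    (convex_ball (0 : ℂ) 1).isPreconnected ?_ ?_ (by simpa using ht)
  · rw [mem_ball_zero_iff, Complex.norm_real]; norm_num
  · refine frequently_eq_of_eqOn_Ioo fun x hx0 hx1 => ?_
    have h := serS_eq ha ha1 hx0.le hx1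
    have h1 : (0 : ℝ) ≤ 1 - x := by linarith
    simp only [Pi.neg_apply]
    rw [← ofReal_powerSum, ← ofReal_powerSum, ← Complex.ofReal_one, ← Complex.ofReal_sub,
      ← Complex.ofReal_log h1]
    change ((serS a x : ℝ) : ℂ) = -((serF a x : ℝ) : ℂ) * _
    rw [h]
    push_cast
    ring

/-- The series with the weights `weightS` on the closed disc. -/
theorem seriesSum_weightS {t : ℂ} (ht : ‖t‖ ≤ 1) (ht1 : t ≠ 1) :
    SeriesConverges (fun k => ((coeffA a k * weightS a k : ℝ) : ℂ) * t ^ k) ∧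
      seriesSum (fun k => ((coeffA a k * weightS a k : ℝ) : ℂ) * t ^ k) =
        -legendreP (-a) (1 - 2 * t) * Complex.log (1 - t) := by
  have hconv := seriesConverges_of_antitone
    (fun k hk => coeffA_mul_weightS_succ_le ha ha1 hk) (tendsto_coeffA_mul_weightS ha ha1) ht ht1
  refine ⟨hconv, ?_⟩
  have hslit := one_sub_mem_slitPlane ht ht1
  have hAbel := tendsto_powerSum_mul_ofReal
    (c := fun k => ((coeffA a k * weightS a k : ℝ) : ℂ)) (by simp [weightS_zero]) hconv
  have hcont : ContinuousAt (fun t => -legendreP (-a) (1 - 2 * t) * Complex.log (1 - t)) t :=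
    ((differentiableAt_legendreP_one_sub ha ha1 hslit).continuousAt.neg).mul
      (ContinuousAt.clog (by fun_prop) hslit)
  have hr : Tendsto (fun r : ℝ => t * (r : ℂ)) (𝓝[<] 1) (𝓝 t) := by
    have : ContinuousAt (fun r : ℝ => t * (r : ℂ)) 1 := by fun_prop
    simpa using this.tendsto.mono_left (nhdsWithin_le_nhds (s := Set.Iio (1 : ℝ)))
  refine tendsto_nhds_unique hAbel ((hcont.tendsto.comp hr).congr' ?_)
  filter_upwards [Ioo_mem_nhdsLT (zero_lt_one' ℝ)] with r hr
  refine (powerSum_weightS_eq ha ha1 ?_).symm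
  rw [norm_mul, Complex.norm_real, Real.norm_of_nonneg hr.1.le]
  exact (mul_le_of_le_one_left hr.1.le ht).trans_lt hr.2

/-- The identity for the harmonic weights on the slit disc. -/
lemma neg_powerSum_weightH_eq {c : ℝ} (hc : 0 < c)
    (hC : Tendsto (fun k => weightS a k - 2 * weightH k) atTop (𝓝 (Real.log c)))
    {t : ℂ} (ht : ‖t‖ < 1) (hts : t ∈ Complex.slitPlane) :
    -powerSum (fun k => ((coeffA a k * weightH k : ℝ) : ℂ)) t =
      closedForm (-a) (2 * Real.sin (Real.pi * a)) c t := by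
  have hopen : IsOpen (Metric.ball (0 : ℂ) 1 ∩ Complex.slitPlane) :=
    Metric.isOpen_ball.inter Complex.isOpen_slitPlane
  have hhalf : ((1 / 2 : ℝ) : ℂ) ∈ Metric.ball (0 : ℂ) 1 ∩ Complex.slitPlane := by
    refine ⟨?_, ?_⟩
    · rw [mem_ball_zero_iff, Complex.norm_real]; norm_num
    · rw [Complex.ofReal_mem_slitPlane]; norm_num
  have hpre : IsPreconnected (Metric.ball (0 : ℂ) 1 ∩ Complex.slitPlane) :=
    ((((convex_ball (0 : ℂ) 1).starConvex hhalf.1).inter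
      (Complex.starConvex_ofReal_slitPlane (by norm_num))).isPathConnected
        hhalf).isConnected.isPreconnected
  have hR : AnalyticOnNhd ℂ (closedForm (-a) (2 * Real.sin (Real.pi * a)) c)
      (Metric.ball (0 : ℂ) 1 ∩ Complex.slitPlane) := by
    refine DifferentiableOn.analyticOnNhd (fun z hz => ?_) hopen
    refine (differentiableAt_closedForm ha ha1 hc _ hz.2
      (one_sub_mem_slitPlane (mem_ball_zero_iff.1 hz.1).le ?_)).differentiableWithinAt
    rintro rfl
    simp at hz
  refine AnalyticOnNhd.eqOn_of_preconnected_of_frequently_eq (z₀ := ((1 / 2 : ℝ) : ℂ))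
    ((((tempered_T ha ha1).ofReal).analyticOnNhd.mono Set.inter_subset_left).neg) hR hpre hhalf ?_
    ⟨by simpa using ht, hts⟩
  refine frequently_eq_of_eqOn_Ioo fun x hx0 hx1 => ?_
  have h := serF_one_sub_eq ha ha1 hC hx0 hx1
  have hx1' : 0 < 1 - x := by linarith
  have n1 : ‖(x : ℂ)‖ < 1 := by rw [Complex.norm_real, Real.norm_of_nonneg hx0.le]; exact hx1
  have n2 : ‖((1 - x : ℝ) : ℂ)‖ < 1 := by
    rw [Complex.norm_real, Real.norm_of_nonneg hx1'.le]; linarith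
  have e1 : legendreP (-a) (1 - 2 * (x : ℂ)) = ((serF a x : ℝ) : ℂ) := by
    rw [legendreP_eq_powerSum ha ha1 n1, serF, ofReal_powerSum]
  have e2 : legendreP (-a) (2 * (x : ℂ) - 1) = ((serF a (1 - x) : ℝ) : ℂ) := by
    have := legendreP_eq_powerSum ha ha1 n2
    rw [serF, ofReal_powerSum, ← this]
    congr 1; push_cast; ring
  have e3 : Complex.log ((c : ℂ) * (1 - x) / x) =
      ((Real.log c + Real.log (1 - x) - Real.log x : ℝ) : ℂ) := by
    rw [← Real.log_mul hc.ne' hx1'.ne', ← Real.log_div (by positivity) hx0.ne',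
      Complex.ofReal_log (by positivity)]
    push_cast; rfl
  rw [closedForm, e1, e2, e3, Pi.neg_apply, ← ofReal_powerSum]
  change -((serT a x : ℝ) : ℂ) = _
  have hs := sin_pi_mul_pos ha ha1
  have hpi := Real.pi_pos
  have hT : -serT a x = -(Real.pi * serF a (1 - x) / (2 * Real.sin (Real.pi * a))) +
      serF a x / 2 * (Real.log c + Real.log (1 - x) - Real.log x) := by
    rw [h]; field_simp; ring
  exact_mod_cast hT

end

/-! ### The series with harmonic weights on the closed disc -/

section

variable {a : ℝ} (ha : 0 < a) (ha1 : a < 1)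
include ha ha1

lemma seriesConverges_weightH {t : ℂ} (ht : ‖t‖ ≤ 1) (ht1 : t ≠ 1) :
    SeriesConverges (fun k => ((coeffA a k * weightH k : ℝ) : ℂ) * t ^ k) :=
  seriesConverges_of_antitone (fun _ hk => coeffA_mul_weightH_succ_le ha ha1 hk)
    (tendsto_coeffA_mul_weightH ha ha1) ht ht1

lemma seriesSum_weightH_eq_powerSum {t : ℂ} (ht : ‖t‖ < 1) :
    seriesSum (fun k => ((coeffA a k * weightH k : ℝ) : ℂ) * t ^ k) =
      powerSum (fun k => ((coeffA a k * weightH k : ℝ) : ℂ)) t :=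
  seriesSum_eq (tendsto_partialSum_powerSum (tempered_T ha ha1).ofReal (by simp [weightH_zero]) ht)

lemma neg_seriesSum_weightH {c : ℝ} (hc : 0 < c)
    (hC : Tendsto (fun k => weightS a k - 2 * weightH k) atTop (𝓝 (Real.log c)))
    {t : ℂ} (ht : ‖t‖ ≤ 1) (ht1 : t ≠ 1) (hts : t ∈ Complex.slitPlane) :
    -seriesSum (fun k => ((coeffA a k * weightH k : ℝ) : ℂ) * t ^ k) =
      closedForm (-a) (2 * Real.sin (Real.pi * a)) c t := by
  have hAbel := (tendsto_powerSum_mul_ofReal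
    (c := fun k => ((coeffA a k * weightH k : ℝ) : ℂ)) (by simp [weightH_zero])
    (seriesConverges_weightH ha ha1 ht ht1)).neg
  have hcont := (differentiableAt_closedForm ha ha1 hc (2 * Real.sin (Real.pi * a)) hts
    (one_sub_mem_slitPlane ht ht1)).continuousAt
  have hr : Tendsto (fun r : ℝ => t * (r : ℂ)) (𝓝[<] 1) (𝓝 t) := by
    have : ContinuousAt (fun r : ℝ => t * (r : ℂ)) 1 := by fun_prop
    simpa using this.tendsto.mono_left (nhdsWithin_le_nhds (s := Set.Iio (1 : ℝ)))
  refine tendsto_nhds_unique hAbel ((hcont.tendsto.comp hr).congr' ?_)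
  have hslit := hr.eventually (Complex.isOpen_slitPlane.mem_nhds hts)
  filter_upwards [Ioo_mem_nhdsLT (zero_lt_one' ℝ), hslit] with r hr hrs
  refine (neg_powerSum_weightH_eq ha ha1 hc hC ?_ hrs).symm
  rw [norm_mul, Complex.norm_real, Real.norm_of_nonneg hr.1.le]
  exact (mul_le_of_le_one_left hr.1.le ht).trans_lt hr.2

/-- The closed form has boundary values at `-1` from both half-planes, along nontangential paths. -/
lemma exists_tendsto_closedForm_neg_one {c : ℝ} (hc : 0 < c) (r : ℝ) {σ : ℝ} (hσ : σ ≠ 0) :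
    ∃ L : ℂ, ∀ v : ℝ → ℂ, Tendsto v (𝓝[>] 0) (𝓝[{z : ℂ | 0 < σ * z.im}] (-1)) →
      (∀ᶠ ε in 𝓝[>] (0 : ℝ), ∀ X ∈ Set.Ioo (0 : ℝ) 1,
        |1 - 2 * X| ≤ 2 * ‖1 - (1 - v ε) * (X : ℂ)‖) →
      Tendsto (fun ε => closedForm (-a) r c (v ε)) (𝓝[>] 0) (𝓝 L) := by
  obtain ⟨L, hL⟩ := exists_tendsto_eulerIntegral ha ha1 (neg_ne_zero.2 hσ)
  obtain ⟨M, hM⟩ := exists_tendsto_log (neg_ne_zero.2 hσ) (x := -2 * c) (by linarith)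
  refine ⟨-((Real.pi : ℂ) * (((Real.sin (Real.pi * a) / Real.pi : ℝ) : ℂ) * L) / (r : ℂ)) +
    legendreP (-a) (1 - 2 * (-1)) / 2 * M, fun v hv hb => ?_⟩
  have hv1 : Tendsto v (𝓝[>] 0) (𝓝 (-1)) := hv.mono_right nhdsWithin_le_nhds
  have hvσ : ∀ᶠ ε in 𝓝[>] (0 : ℝ), 0 < σ * (v ε).im := (tendsto_nhdsWithin_iff.1 hv).2
  have t1 : Tendsto (fun ε => 1 - v ε) (𝓝[>] 0) (𝓝[{z : ℂ | 0 < -σ * z.im}] 2) := by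
    refine tendsto_nhdsWithin_iff.2 ⟨?_, ?_⟩
    · have := hv1.const_sub 1
      norm_num at this
      exact this
    · filter_upwards [hvσ] with ε hε
      simpa using hε
  have t2 : Tendsto (fun ε => legendreP (-a) (1 - 2 * v ε)) (𝓝[>] 0)
      (𝓝 (legendreP (-a) (1 - 2 * (-1)))) :=
    ((differentiableAt_legendreP_one_sub ha ha1
      (one_sub_mem_slitPlane (by simp) (by norm_num))).continuousAt.tendsto).comp hv1
  have t3 : Tendsto (fun ε => (c : ℂ) * (1 - v ε) / v ε) (𝓝[>] 0)
      (𝓝[{z : ℂ | 0 < -σ * z.im}] ((-2 * c : ℝ) : ℂ)) := by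
    refine tendsto_nhdsWithin_iff.2 ⟨?_, ?_⟩
    · have e : ((-2 * c : ℝ) : ℂ) = (c : ℂ) * (1 - (-1)) / (-1) := by push_cast; ring
      rw [e]
      exact ((hv1.const_sub 1).const_mul (c : ℂ)).div hv1 (by norm_num)
    · filter_upwards [hvσ] with ε hε
      have h0 : v ε ≠ 0 := fun h => by simp [h] at hε
      have e : (c : ℂ) * (1 - v ε) / v ε = (c : ℂ) * ((v ε)⁻¹ - 1) := by field_simp
      have hn : 0 < Complex.normSq (v ε) := Complex.normSq_pos.2 h0
      change 0 < -σ * ((c : ℂ) * (1 - v ε) / v ε).im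
      rw [e, Complex.im_ofReal_mul, Complex.sub_im, Complex.inv_im, Complex.one_im, sub_zero,
        show -σ * (c * (-(v ε).im / Complex.normSq (v ε))) =
          c * (σ * (v ε).im) / Complex.normSq (v ε) by ring]
      positivity
  have h1 := ((hL _ t1 hb).const_mul ((Real.sin (Real.pi * a) / Real.pi : ℝ) : ℂ))
  have h := (((h1.const_mul (Real.pi : ℂ)).div_const (r : ℂ)).neg).add
    ((t2.div_const 2).mul (hM.comp t3))
  refine h.congr fun ε => ?_
  rw [closedForm, legendreP_two_mul_sub_one ha]
  rfl

/-- The limit of the closed form at `t ± i ε`, the sign being that of `σ`, for `-1 ≤ t < 0`. For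
`t = -1` it is identified by Abel's theorem along a nonreal direction into the disc. -/
lemma tendsto_closedForm_vertical {c : ℝ} (hc : 0 < c)
    (hC : Tendsto (fun k => weightS a k - 2 * weightH k) atTop (𝓝 (Real.log c)))
    {σ : ℝ} (hσ : σ ^ 2 = 1) {t : ℝ} (ht : -1 ≤ t) (ht0 : t < 0) :
    Tendsto (fun ε : ℝ => closedForm (-a) (2 * Real.sin (Real.pi * a)) c
        ((t : ℂ) + Complex.I * ((σ * ε : ℝ) : ℂ))) (𝓝[>] 0)
      (𝓝 (-seriesSum (fun k => ((coeffA a k * weightH k : ℝ) : ℂ) * (t : ℂ) ^ k))) := by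
  have hσ0 : σ ≠ 0 := fun h => by simp [h] at hσ
  rcases ht.lt_or_eq with ht' | rfl
  · have hn : ‖(t : ℂ)‖ < 1 := by
      rw [Complex.norm_real, Real.norm_eq_abs, abs_lt]; constructor <;> linarith
    rw [seriesSum_weightH_eq_powerSum ha ha1 hn]
    have hu : Tendsto (fun ε : ℝ => (t : ℂ) + Complex.I * ((σ * ε : ℝ) : ℂ)) (𝓝[>] 0)
        (𝓝 (t : ℂ)) := by
      have : ContinuousAt (fun ε : ℝ => (t : ℂ) + Complex.I * ((σ * ε : ℝ) : ℂ)) 0 := by fun_prop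
      simpa using this.tendsto.mono_left (nhdsWithin_le_nhds (s := Set.Ioi (0 : ℝ)))
    have hlim := (((tempered_T ha ha1).ofReal.hasDerivAt hn).continuousAt.tendsto.comp hu).neg
    refine hlim.congr' ?_
    have hball := hu.eventually (Metric.isOpen_ball.mem_nhds (mem_ball_zero_iff.2 hn))
    filter_upwards [hball, self_mem_nhdsWithin] with ε hε hε0
    have hε0' : 0 < ε := hε0
    refine neg_powerSum_weightH_eq ha ha1 hc hC (mem_ball_zero_iff.1 hε) ?_
    rw [Complex.mem_slitPlane_iff]
    right
    simp [hσ0, hε0'.ne']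
  · obtain ⟨L, hL⟩ := exists_tendsto_closedForm_neg_one ha ha1 hc (2 * Real.sin (Real.pi * a)) hσ0
    have hpath : ∀ w : ℂ, 0 < σ * w.im → Tendsto (fun ε : ℝ => -1 + (ε : ℂ) * w) (𝓝[>] 0)
        (𝓝[{z : ℂ | 0 < σ * z.im}] (-1)) := by
      intro w hw
      refine tendsto_nhdsWithin_iff.2 ⟨?_, ?_⟩
      · have : ContinuousAt (fun ε : ℝ => -1 + (ε : ℂ) * w) 0 := by fun_prop
        simpa using this.tendsto.mono_left (nhdsWithin_le_nhds (s := Set.Ioi (0 : ℝ)))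
      · filter_upwards [self_mem_nhdsWithin] with ε hε
        have hε' : 0 < ε := hε
        have := mul_pos hε' hw
        simp
        linarith
    have hsq : ∀ (y : ℝ) (z : ℂ), y ^ 2 ≤ 4 * (z.re ^ 2 + z.im ^ 2) → |y| ≤ 2 * ‖z‖ := by
      intro y z h
      refine abs_le_of_sq_le_sq ?_ (by positivity)
      rw [mul_pow, Complex.sq_norm, Complex.normSq_apply]
      linarith
    -- the vertical path; here `|1 - s X| ≥ |1 - 2 X|`
    have h1 := hL (fun ε => -1 + (ε : ℂ) * (σ * Complex.I)) (hpath _ (by simp; nlinarith)) (by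
      refine Eventually.of_forall fun ε X hX => hsq _ _ ?_
      simp
      nlinarith [sq_nonneg (1 - 2 * X), sq_nonneg (ε * σ * X)])
    -- a path into the disc in the direction `1 + σ i`, where the closed form is the power series
    have h2 := hL (fun ε => -1 + (ε : ℂ) * (1 + σ * Complex.I)) (hpath _ (by simp; nlinarith)) (by
      refine Eventually.of_forall fun ε X hX => hsq _ _ ?_
      simp
      nlinarith [sq_nonneg (1 - 2 * X + 2 * (ε * X))])
    have hcone : Tendsto (fun ε : ℝ => 1 - (ε : ℂ) * (1 + σ * Complex.I)) (𝓝[>] 0)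
        (𝓝[Complex.stolzCone 2] 1) := by
      refine tendsto_nhdsWithin_iff.2 ⟨?_, ?_⟩
      · have : ContinuousAt (fun ε : ℝ => 1 - (ε : ℂ) * (1 + σ * Complex.I)) 0 := by fun_prop
        simpa using this.tendsto.mono_left (nhdsWithin_le_nhds (s := Set.Ioi (0 : ℝ)))
      · filter_upwards [self_mem_nhdsWithin] with ε hε
        have hε' : 0 < ε := hε
        have hσ1 : |σ| = 1 := by rw [← sq_eq_sq₀ (abs_nonneg _) zero_le_one, sq_abs, hσ, one_pow]
        simp [Complex.stolzCone, abs_mul, hσ1, abs_of_pos hε']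
        linarith
    have h3 := ((tendsto_powerSum_mul_nhdsWithin_stolzCone
      (c := fun k => ((coeffA a k * weightH k : ℝ) : ℂ)) (t := ((-1 : ℝ) : ℂ))
      (by simp [weightH_zero])
      (seriesConverges_weightH ha ha1 (by simp) (by norm_num)) two_pos).comp hcone).neg
    have hLeq : L = -seriesSum (fun k => ((coeffA a k * weightH k : ℝ) : ℂ) *
        ((-1 : ℝ) : ℂ) ^ k) := by
      refine tendsto_nhds_unique h2 (h3.congr' ?_)
      filter_upwards [Ioo_mem_nhdsGT (zero_lt_one' ℝ)] with ε hε
      have hε0 := hε.1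
      have e : ((-1 : ℝ) : ℂ) * (1 - (ε : ℂ) * (1 + σ * Complex.I)) =
          -1 + (ε : ℂ) * (1 + σ * Complex.I) := by push_cast; ring
      simp only [Function.comp]
      rw [e]
      refine neg_powerSum_weightH_eq ha ha1 hc hC ?_ ?_
      · rw [← sq_lt_one_iff₀ (norm_nonneg _), Complex.sq_norm, Complex.normSq_apply]
        simp
        have := mul_pos hε.1 (sub_pos.2 hε.2)
        nlinarith
      · rw [Complex.mem_slitPlane_iff]
        right
        simp [hσ0, hε0.ne']
    rw [← hLeq]
    refine h1.congr fun ε => ?_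
    congr 1
    push_cast; ring

/-- The evaluation of the series with harmonic weights, for every `a ∈ (0, 1)`: the constant in the
logarithm is `exp (lim (hₖ - 2 Hₖ))`. -/
theorem tildeEvaluation_of_coeff {b : ℂ → ℕ → ℂ} (hb : ∀ t k, b t k = (coeffA a k : ℂ) * t ^ k)
    {c : ℝ} (hc : 0 < c)
    (hC : Tendsto (fun k => weightS a k - 2 * weightH k) atTop (𝓝 (Real.log c))) :
    TildeEvaluation b (-a) (2 * Real.sin (Real.pi * a)) c := by
  have hterm : ∀ t : ℂ, (fun k => b t k * H k) =
      fun k => ((coeffA a k * weightH k : ℝ) : ℂ) * t ^ k := by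
    intro t; ext k
    rw [hb, H, weightH]; push_cast; ring
  have hS : ∀ t, STilde b t =
      -seriesSum (fun k => ((coeffA a k * weightH k : ℝ) : ℂ) * t ^ k) := fun t => by
    rw [STilde, hterm]
  refine ⟨fun t ht ht1 htn => ?_, fun t ht ht0 => ?_⟩
  · rw [hterm, hS]
    refine ⟨seriesConverges_weightH ha ha1 ht ht1, neg_seriesSum_weightH ha ha1 hc hC ht ht1 ?_⟩
    rw [Complex.mem_slitPlane_iff]
    by_contra! h
    refine htn ⟨t.re, ?_, h.1, Complex.ext (by simp) (by simpa using h.2)⟩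
    have := (Complex.abs_re_le_norm t).trans ht
    linarith [(abs_le.1 this).1]
  · have hn : ‖(t : ℂ)‖ ≤ 1 := by
      rw [Complex.norm_real, Real.norm_eq_abs, abs_le]; constructor <;> linarith
    have hne : (t : ℂ) ≠ 1 := by
      have : t ≠ 1 := by linarith
      exact_mod_cast this
    have hp := tendsto_closedForm_vertical ha ha1 hc hC (σ := 1) (by norm_num) ht ht0
    have hm := tendsto_closedForm_vertical ha ha1 hc hC (σ := -1) (by norm_num) ht ht0
    rw [hterm, hS]
    refine ⟨seriesConverges_weightH ha ha1 hn hne, ⟨?_, ?_⟩, fun ht' => ?_⟩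
    · refine hp.congr fun ε => ?_
      rw [one_mul]
    · refine hm.congr fun ε => ?_
      congr 1; push_cast; ring
    · have hn' : ‖(t : ℂ)‖ < 1 := by
        rw [Complex.norm_real, Real.norm_eq_abs, abs_lt]; constructor <;> linarith
      have hcont : ContinuousAt (STilde b) t := by
        have h := ((tempered_T ha ha1).ofReal.hasDerivAt hn').continuousAt.neg
        refine h.congr ?_
        filter_upwards [Metric.isOpen_ball.mem_nhds (mem_ball_zero_iff.2 hn')] with z hz
        rw [hS, seriesSum_weightH_eq_powerSum ha ha1 (mem_ball_zero_iff.1 hz)]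
        rfl
      rw [← hS]
      refine ⟨hcont.tendsto.comp ?_, hcont.tendsto.comp ?_⟩
      · have : ContinuousAt (fun ε : ℝ => (t : ℂ) + Complex.I * (ε : ℂ)) 0 := by fun_prop
        simpa using this.tendsto.mono_left (nhdsWithin_le_nhds (s := Set.Ioi (0 : ℝ)))
      · have : ContinuousAt (fun ε : ℝ => (t : ℂ) - Complex.I * (ε : ℂ)) 0 := by fun_prop
        simpa using this.tendsto.mono_left (nhdsWithin_le_nhds (s := Set.Ioi (0 : ℝ)))

end

/-! ### The coefficients and weights for `a = 1/2, 1/3, 1/4, 1/6` -/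

/-- A sequence with the same recurrence as `cᵏ Aₖ` is `cᵏ Aₖ`. -/
lemma eq_pow_mul_coeffA {a c : ℝ} {N : ℕ → ℝ} (h0 : N 0 = 1)
    (hN : ∀ k : ℕ, ((k : ℝ) + 1) ^ 2 * N (k + 1) = c * ((k + a) * (k + 1 - a)) * N k) (k : ℕ) :
    N k = c ^ k * coeffA a k := by
  induction k with
  | zero => simp [h0, coeffA_zero]
  | succ k ih =>
    apply mul_left_cancel₀ (show ((k : ℝ) + 1) ^ 2 ≠ 0 by positivity)
    rw [hN, ih, pow_succ]
    linear_combination (-(c ^ k * c)) * coeffA_succ (a := a) k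

lemma base2_eq (t : ℂ) (k : ℕ) : base2 t k = (coeffA (1 / 2) k : ℂ) * t ^ k := by
  have h := eq_pow_mul_coeffA (a := 1 / 2) (c := 2 ^ 4)
    (N := fun k => ((2 * k).choose k : ℝ) ^ 2) (by simp) (fun k => ?_) k
  · have h' : (((2 * k).choose k : ℕ) : ℂ) ^ 2 = (2 ^ 4) ^ k * (coeffA (1 / 2) k : ℂ) := by
      exact_mod_cast h
    rw [base2, h', div_pow]
    field_simp
  · rw [Nat.cast_choose ℝ (by omega), Nat.cast_choose ℝ (by omega),
      show 2 * (k + 1) - (k + 1) = k + 1 by omega, show 2 * k - k = k by omega,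
      show 2 * (k + 1) = 2 * k + 1 + 1 by ring]
    have := (2 * k).factorial_pos
    have := k.factorial_pos
    simp only [Nat.factorial_succ]
    push_cast
    field_simp
    ring

lemma base3_eq (t : ℂ) (k : ℕ) : base3 t k = (coeffA (1 / 3) k : ℂ) * t ^ k := by
  have h := eq_pow_mul_coeffA (a := 1 / 3) (c := 3 ^ 3)
    (N := fun k => ((2 * k).choose k : ℝ) * ((3 * k).choose k : ℝ)) (by simp) (fun k => ?_) k
  · have h' : (((2 * k).choose k : ℕ) : ℂ) * (((3 * k).choose k : ℕ) : ℂ) =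
        (3 ^ 3) ^ k * (coeffA (1 / 3) k : ℂ) := by
      exact_mod_cast h
    rw [base3, h', div_pow]
    field_simp
  · rw [Nat.cast_choose ℝ (by omega), Nat.cast_choose ℝ (by omega), Nat.cast_choose ℝ (by omega),
      Nat.cast_choose ℝ (by omega),
      show 2 * (k + 1) - (k + 1) = k + 1 by omega, show 2 * k - k = k by omega,
      show 3 * (k + 1) - (k + 1) = 2 * k + 1 + 1 by omega, show 3 * k - k = 2 * k by omega,
      show 2 * (k + 1) = 2 * k + 1 + 1 by ring, show 3 * (k + 1) = 3 * k + 1 + 1 + 1 by ring]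
    have := (2 * k).factorial_pos
    have := (3 * k).factorial_pos
    have := k.factorial_pos
    simp only [Nat.factorial_succ]
    push_cast
    field_simp
    ring

lemma base4_eq (t : ℂ) (k : ℕ) : base4 t k = (coeffA (1 / 4) k : ℂ) * t ^ k := by
  have h := eq_pow_mul_coeffA (a := 1 / 4) (c := 2 ^ 6)
    (N := fun k => ((2 * k).choose k : ℝ) * ((4 * k).choose (2 * k) : ℝ)) (by simp)
    (fun k => ?_) k
  · have h' : (((2 * k).choose k : ℕ) : ℂ) * (((4 * k).choose (2 * k) : ℕ) : ℂ) =
        (2 ^ 6) ^ k * (coeffA (1 / 4) k : ℂ) := by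
      exact_mod_cast h
    rw [base4, h', div_pow]
    field_simp
  · rw [Nat.cast_choose ℝ (by omega), Nat.cast_choose ℝ (by omega), Nat.cast_choose ℝ (by omega),
      Nat.cast_choose ℝ (by omega),
      show 2 * (k + 1) - (k + 1) = k + 1 by omega, show 2 * k - k = k by omega,
      show 4 * (k + 1) - 2 * (k + 1) = 2 * k + 1 + 1 by omega,
      show 4 * k - 2 * k = 2 * k by omega,
      show 2 * (k + 1) = 2 * k + 1 + 1 by ring, show 4 * (k + 1) = 4 * k + 1 + 1 + 1 + 1 by ring]
    have := (2 * k).factorial_pos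
    have := (4 * k).factorial_pos
    have := k.factorial_pos
    simp only [Nat.factorial_succ]
    push_cast
    field_simp
    ring

lemma base6_eq (t : ℂ) (k : ℕ) : base6 t k = (coeffA (1 / 6) k : ℂ) * t ^ k := by
  have h := eq_pow_mul_coeffA (a := 1 / 6) (c := 2 ^ 4 * 3 ^ 3)
    (N := fun k => ((3 * k).choose k : ℝ) * ((6 * k).choose (3 * k) : ℝ)) (by simp)
    (fun k => ?_) k
  · have h' : (((3 * k).choose k : ℕ) : ℂ) * (((6 * k).choose (3 * k) : ℕ) : ℂ) =
        (2 ^ 4 * 3 ^ 3) ^ k * (coeffA (1 / 6) k : ℂ) := by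
      exact_mod_cast h
    rw [base6, h', div_pow]
    field_simp
  · rw [Nat.cast_choose ℝ (by omega), Nat.cast_choose ℝ (by omega), Nat.cast_choose ℝ (by omega),
      Nat.cast_choose ℝ (by omega),
      show 3 * (k + 1) - (k + 1) = 2 * k + 1 + 1 by omega, show 3 * k - k = 2 * k by omega,
      show 6 * (k + 1) - 3 * (k + 1) = 3 * k + 1 + 1 + 1 by omega,
      show 6 * k - 3 * k = 3 * k by omega,
      show 3 * (k + 1) = 3 * k + 1 + 1 + 1 by ring,
      show 6 * (k + 1) = 6 * k + 1 + 1 + 1 + 1 + 1 + 1 by ring]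
    have := (2 * k).factorial_pos
    have := (3 * k).factorial_pos
    have := (6 * k).factorial_pos
    have := k.factorial_pos
    simp only [Nat.factorial_succ]
    push_cast
    field_simp
    ring

lemma weightS_half (k : ℕ) :
    weightS (1 / 2) k = 2 * (2 * weightH (2 * k) - weightH k) := by
  induction k with
  | zero => simp [weightS_zero, weightH_zero]
  | succ k ih =>
    rw [weightS, Finset.sum_range_succ, ← weightS, ih, show 2 * (k + 1) = 2 * k + 1 + 1 by ring]
    simp only [weightH_succ]
    push_cast
    rw [show (k : ℝ) + 1 - 1 / 2 = (2 * k + 1) / 2 by ring,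
      show (k : ℝ) + 1 / 2 = (2 * k + 1) / 2 by ring]
    field_simp
    ring

lemma weightS_third (k : ℕ) :
    weightS (1 / 3) k = 3 * weightH (3 * k) - weightH k := by
  induction k with
  | zero => simp [weightS_zero, weightH_zero]
  | succ k ih =>
    rw [weightS, Finset.sum_range_succ, ← weightS, ih, show 3 * (k + 1) = 3 * k + 1 + 1 + 1 by ring]
    simp only [weightH_succ]
    push_cast
    rw [show (k : ℝ) + 1 - 1 / 3 = (3 * k + 2) / 3 by ring,
      show (k : ℝ) + 1 / 3 = (3 * k + 1) / 3 by ring]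
    field_simp
    ring

lemma weightS_quarter (k : ℕ) :
    weightS (1 / 4) k = 2 * (2 * weightH (4 * k) - weightH (2 * k)) := by
  induction k with
  | zero => simp [weightS_zero, weightH_zero]
  | succ k ih =>
    rw [weightS, Finset.sum_range_succ, ← weightS, ih,
      show 4 * (k + 1) = 4 * k + 1 + 1 + 1 + 1 by ring, show 2 * (k + 1) = 2 * k + 1 + 1 by ring]
    simp only [weightH_succ]
    push_cast
    rw [show (k : ℝ) + 1 - 1 / 4 = (4 * k + 3) / 4 by ring,
      show (k : ℝ) + 1 / 4 = (4 * k + 1) / 4 by ring]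
    field_simp
    ring

lemma weightS_sixth (k : ℕ) :
    weightS (1 / 6) k =
      6 * weightH (6 * k) - 3 * weightH (3 * k) - 2 * weightH (2 * k) + weightH k := by
  induction k with
  | zero => simp [weightS_zero, weightH_zero]
  | succ k ih =>
    rw [weightS, Finset.sum_range_succ, ← weightS, ih,
      show 6 * (k + 1) = 6 * k + 1 + 1 + 1 + 1 + 1 + 1 by ring,
      show 3 * (k + 1) = 3 * k + 1 + 1 + 1 by ring, show 2 * (k + 1) = 2 * k + 1 + 1 by ring]
    simp only [weightH_succ]
    push_cast
    rw [show (k : ℝ) + 1 - 1 / 6 = (6 * k + 5) / 6 by ring,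
      show (k : ℝ) + 1 / 6 = (6 * k + 1) / 6 by ring]
    field_simp
    ring

/-- `H_{mk} - H_k → log m`. -/
lemma tendsto_weightH_mul_sub {m : ℕ} (hm : 0 < m) :
    Tendsto (fun k => weightH (m * k) - weightH k) atTop (𝓝 (Real.log m)) := by
  have h := Real.tendsto_harmonic_sub_log
  have hmk : Tendsto (fun k : ℕ => m * k) atTop atTop :=
    tendsto_id.const_mul_atTop' hm
  have h2 := ((h.comp hmk).sub h).add_const (Real.log m)
  rw [sub_self, zero_add] at h2
  refine h2.congr' ?_
  filter_upwards [eventually_ge_atTop 1] with k hk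
  have hk' : (k : ℝ) ≠ 0 := by exact_mod_cast (by omega : k ≠ 0)
  have hm' : (m : ℝ) ≠ 0 := by exact_mod_cast hm.ne'
  simp only [Function.comp, weightH]
  push_cast
  rw [Real.log_mul hm' hk']
  ring

lemma tendsto_weightS_half_sub :
    Tendsto (fun k => weightS (1 / 2) k - 2 * weightH k) atTop (𝓝 (Real.log (2 ^ 4))) := by
  have h := (tendsto_weightH_mul_sub two_pos).const_mul 4
  rw [Real.log_pow]
  refine (h.congr fun k => ?_)
  rw [weightS_half]; ring

lemma tendsto_weightS_third_sub :
    Tendsto (fun k => weightS (1 / 3) k - 2 * weightH k) atTop (𝓝 (Real.log (3 ^ 3))) := by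
  have h := (tendsto_weightH_mul_sub three_pos).const_mul 3
  rw [Real.log_pow]
  refine (h.congr fun k => ?_)
  rw [weightS_third]; ring

lemma tendsto_weightS_quarter_sub :
    Tendsto (fun k => weightS (1 / 4) k - 2 * weightH k) atTop (𝓝 (Real.log (2 ^ 6))) := by
  have h := ((tendsto_weightH_mul_sub four_pos).const_mul 4).sub
    ((tendsto_weightH_mul_sub two_pos).const_mul 2)
  have e : (4 : ℝ) * Real.log (4 : ℕ) - 2 * Real.log (2 : ℕ) = Real.log (2 ^ 6) := by
    rw [show ((4 : ℕ) : ℝ) = 2 ^ 2 by norm_num, Real.log_pow, Real.log_pow]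
    push_cast; ring
  rw [e] at h
  refine (h.congr fun k => ?_)
  rw [weightS_quarter]; ring

lemma tendsto_weightS_sixth_sub :
    Tendsto (fun k => weightS (1 / 6) k - 2 * weightH k) atTop
      (𝓝 (Real.log (2 ^ 4 * 3 ^ 3))) := by
  have h := (((tendsto_weightH_mul_sub (show 0 < 6 by norm_num)).const_mul 6).sub
    ((tendsto_weightH_mul_sub three_pos).const_mul 3)).sub
    ((tendsto_weightH_mul_sub two_pos).const_mul 2)
  have e : (6 : ℝ) * Real.log (6 : ℕ) - 3 * Real.log (3 : ℕ) - 2 * Real.log (2 : ℕ) =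
      Real.log (2 ^ 4 * 3 ^ 3) := by
    rw [show ((6 : ℕ) : ℝ) = 2 * 3 by norm_num, Real.log_mul (by norm_num) (by norm_num),
      Real.log_mul (by norm_num) (by norm_num), Real.log_pow, Real.log_pow]
    push_cast; ring
  rw [e] at h
  refine (h.congr fun k => ?_)
  rw [weightS_sixth]; ring

/-- The series with addends `f`, when `z f` is the series with the weights `weightS`. -/
lemma seriesSum_of_weightS {a : ℝ} (ha : 0 < a) (ha1 : a < 1) {t : ℂ} (ht : ‖t‖ ≤ 1) (ht1 : t ≠ 1)
    {f : ℕ → ℂ} {z : ℂ} (hz : z ≠ 0)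
    (hf : ∀ k, z * f k = ((coeffA a k * weightS a k : ℝ) : ℂ) * t ^ k) :
    SeriesConverges f ∧
      z * seriesSum f = -legendreP (-a) (1 - 2 * t) * Complex.log (1 - t) := by
  obtain ⟨h1, h2⟩ := seriesSum_weightS ha ha1 ht ht1
  have h3 := (tendsto_partialSum h1).const_mul z⁻¹
  have h4 : Tendsto (partialSum f) atTop (𝓝 (z⁻¹ *
      seriesSum fun k => ((coeffA a k * weightS a k : ℝ) : ℂ) * t ^ k)) := by
    refine h3.congr fun n => ?_
    simp only [partialSum, Finset.mul_sum, ← hf]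
    exact Finset.sum_congr rfl fun k _ => inv_mul_cancel_left₀ hz _
  exact ⟨⟨_, h4⟩, by rw [seriesSum_eq h4, mul_inv_cancel_left₀ hz, h2]⟩

lemma H_eq (k : ℕ) : H k = (weightH k : ℂ) := by rw [H, weightH]; push_cast; rfl

end LegendreSun

theorem mainTheorem1 :
    (∀ t : ℂ, ‖t‖ ≤ 1 → t ≠ 1 →
      (LegendreSun.SeriesConverges (LegendreSun.term2 t) ∧
        LegendreSun.S2 t
          = -LegendreSun.legendreP (-1 / 2) (1 - 2 * t) * Complex.log (1 - t)) ∧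
      (LegendreSun.SeriesConverges (LegendreSun.term3 t) ∧
        LegendreSun.S3 t
          = -LegendreSun.legendreP (-1 / 3) (1 - 2 * t) * Complex.log (1 - t)) ∧
      (LegendreSun.SeriesConverges (LegendreSun.term4 t) ∧
        LegendreSun.S4 t
          = -LegendreSun.legendreP (-1 / 4) (1 - 2 * t) * Complex.log (1 - t)) ∧
      (LegendreSun.SeriesConverges (LegendreSun.term6 t) ∧
        LegendreSun.S6 t
          = -LegendreSun.legendreP (-1 / 6) (1 - 2 * t) * Complex.log (1 - t))) ∧
    LegendreSun.TildeEvaluation LegendreSun.base2 (-1 / 2) 2 (2 ^ 4) ∧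
    LegendreSun.TildeEvaluation LegendreSun.base3 (-1 / 3) (Real.sqrt 3) (3 ^ 3) ∧
    LegendreSun.TildeEvaluation LegendreSun.base4 (-1 / 4) (Real.sqrt 2) (2 ^ 6) ∧
    LegendreSun.TildeEvaluation LegendreSun.base6 (-1 / 6) 1 (2 ^ 4 * 3 ^ 3) := by
  have p2 : (0 : ℝ) < 1 / 2 ∧ (1 / 2 : ℝ) < 1 := by norm_num
  have p3 : (0 : ℝ) < 1 / 3 ∧ (1 / 3 : ℝ) < 1 := by norm_num
  have p4 : (0 : ℝ) < 1 / 4 ∧ (1 / 4 : ℝ) < 1 := by norm_num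
  have p6 : (0 : ℝ) < 1 / 6 ∧ (1 / 6 : ℝ) < 1 := by norm_num
  refine ⟨fun t ht ht1 => ⟨?_, ?_, ?_, ?_⟩, ?_, ?_, ?_, ?_⟩
  · have h := LegendreSun.seriesSum_of_weightS p2.1 p2.2 ht ht1 (f := LegendreSun.term2 t)
      (z := 2) two_ne_zero fun k => by
        rw [LegendreSun.term2, LegendreSun.base2_eq, LegendreSun.weightS_half]
        simp only [LegendreSun.H_eq]; push_cast; ring
    rw [← neg_div] at h
    exact h
  · have h := LegendreSun.seriesSum_of_weightS p3.1 p3.2 ht ht1 (f := LegendreSun.term3 t)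
      (z := 1) one_ne_zero fun k => by
        rw [LegendreSun.term3, LegendreSun.base3_eq, LegendreSun.weightS_third]
        simp only [LegendreSun.H_eq]; push_cast; ring
    rw [← neg_div, one_mul] at h
    exact h
  · have h := LegendreSun.seriesSum_of_weightS p4.1 p4.2 ht ht1 (f := LegendreSun.term4 t)
      (z := 2) two_ne_zero fun k => by
        rw [LegendreSun.term4, LegendreSun.base4_eq, LegendreSun.weightS_quarter]
        simp only [LegendreSun.H_eq]; push_cast; ring
    rw [← neg_div] at h
    exact h
  · have h := LegendreSun.seriesSum_of_weightS p6.1 p6.2 ht ht1 (f := LegendreSun.term6 t)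
      (z := 1) one_ne_zero fun k => by
        rw [LegendreSun.term6, LegendreSun.base6_eq, LegendreSun.weightS_sixth]
        simp only [LegendreSun.H_eq]; push_cast; ring
    rw [← neg_div, one_mul] at h
    exact h
  · have h := LegendreSun.tildeEvaluation_of_coeff p2.1 p2.2 LegendreSun.base2_eq
      (by norm_num) LegendreSun.tendsto_weightS_half_sub
    rwa [mul_one_div, Real.sin_pi_div_two, mul_one, ← neg_div] at h
  · have h := LegendreSun.tildeEvaluation_of_coeff p3.1 p3.2 LegendreSun.base3_eq
      (by norm_num) LegendreSun.tendsto_weightS_third_sub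
    rwa [mul_one_div, Real.sin_pi_div_three, mul_div_cancel₀ _ two_ne_zero, ← neg_div] at h
  · have h := LegendreSun.tildeEvaluation_of_coeff p4.1 p4.2 LegendreSun.base4_eq
      (by norm_num) LegendreSun.tendsto_weightS_quarter_sub
    rwa [mul_one_div, Real.sin_pi_div_four, mul_div_cancel₀ _ two_ne_zero, ← neg_div] at h
  · have h := LegendreSun.tildeEvaluation_of_coeff p6.1 p6.2 LegendreSun.base6_eq
      (by norm_num) LegendreSun.tendsto_weightS_sixth_sub
    rwa [mul_one_div, Real.sin_pi_div_six, mul_one_div, div_self two_ne_zero, ← neg_div] at h
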